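/- Let $(E,\mathcal B(E),\mu)$ be a $\sigma$-finite measure space, $E$ a Lusin space, $L^2(\mu)$ the real $L^2$-space with norm $|\cdot|_2$, and let $(P_t)_{t\ge 0}$ be a strongly continuous sub-Markovian contraction semigroup on $L^2(\mu)$ whose generator $(L,D(L))$ is self-adjoint and negative definite ($\langle Lu,u\rangle_2\le 0$ for $u\in D(L)$). Put $V_1u=\Gamma(\tfrac12)^{-1}\int_0^\infty t^{-1/2}e^{-t}P_tu\,dt$ $(=(1-L)^{-1/2}u)$, let $F_{1,2}=V_1(L^2(\mu))$ with norm $\|V_1u\|_{F_{1,2}}=|u|_2$, and let $F^*_{1,2}$ be its dual with the dual norm, so that $F_{1,2}\subset L^2(\mu)\equiv (L^2(\mu))^*\subset F^*_{1,2}$; $L$ also denotes the bounded extension $L:F_{1,2}\to F^*_{1,2}$ of the generator, for which $1-L$ is the Riesz isomorphism $F_{1,2}\to F_{1,2}^*$. Let $T>0$, and assume: * (H1) $\Psi:\mathbb R\to\mathbb R$ is nondecreasing and Lipschitz with $\Psi(0)=0$; * (H2) $B:[0,T]\times L^2(\mu)\to L_2(L^2(\mu),F^*_{1,2})$ (Hilbert–Schmidt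 operators) and there are constants $C_1\ge0$, $C_2>0$ such that for all $t\in[0,T]$ and $u,v\in L^2(\mu)$: $\|B(t,u)-B(t,v)\|_{L_2}\le C_1\|u-v\|_{F^*_{1,2}}$ and $\|B(t,u)\|_{L_2}\le C_2(\|u\|_{F^*_{1,2}}+1)$; * (H3) there are $\gamma>0$ and $C\ge0$ such that $\|B(t_1,u)-B(t_2,u)\|_{L_2}\le C(\|u\|_{F^*_{1,2}}+1)|t_1-t_2|^\gamma$ for all $t_1,t_2\in[0,T]$ and $u\in L^2(\mu)$. Let $x\in L^2(\mu)$. For $h\in L^2([0,T];L^2(\mu))$, a solution of the skeleton equation $$dY(t)-L\Psi(Y(t))\,dt=B(t,Y(t))\,h(t)\,dt,\qquad Y(0)=x,$$ is a function $Y\in C([0,T];F^*_{1,2})\cap L^2([0,T];L^2(\mu))$ with $\int_0^\cdot\Psi(Y(s))\,ds\in C([0,T];F_{1,2})$ and $$Y(t)-L\int_0^t\Psi(Y(s))\,ds=x+\int_0^tB(s,Y(s))h(s)\,ds\quad\text{in }F^*_{1,2},\ \text{for all }t\in[0,T].$$ Such a solution is denoted by $\mathcal G^0\big(\int_0^\cdot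 h(s)\,ds\big)$. **Theorem 5.2.** Let $M\in\mathbb R$ and let $h,h_n$ $(n\in\mathbb N)$ belong to $\mathcal S_M=\{h\in L^2([0,T];L^2(\mu)):\int_0^T|h(s)|_2^2\,ds\le M\}$, with $h_n\to h$ weakly in $L^2([0,T];L^2(\mu))$. If $Y^h=\mathcal G^0(\int_0^\cdot h(s)\,ds)$ and $Y^{h_n}=\mathcal G^0(\int_0^\cdot h_n(s)\,ds)$ are solutions of the skeleton equation for $h$ and for $h_n$ with the same initial value $x$, then $Y^{h_n}\to Y^h$ in $C([0,T];F^*_{1,2})$, i.e. $\sup_{t\in[0,T]}\|Y^{h_n}(t)-Y^h(t)\|_{F^*_{1,2}}\to0$ as $n\to\infty$. -/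

import Mathlib

open MeasureTheory Set Filter Topology
open scoped NNReal ENNReal

noncomputable section

theorem integrableOn_rpow_mul_inv :
    IntegrableOn (fun w : ℝ => w ^ (-(1 / 2) : ℝ) * (1 + w)⁻¹) (Ioi 0) := by
  have hm : Measurable fun w : ℝ => w ^ (-(1 / 2) : ℝ) * (1 + w)⁻¹ := by fun_prop
  rw [← Ioc_union_Ioi_eq_Ioi zero_le_one]
  refine IntegrableOn.union ?_ ?_
  · have h : IntegrableOn (fun w : ℝ => w ^ (-(1 / 2) : ℝ)) (Ioc 0 1) :=
      (intervalIntegrable_iff_integrableOn_Ioc_of_le zero_le_one).1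
        (intervalIntegral.intervalIntegrable_rpow' (by norm_num))
    refine h.mono' hm.aestronglyMeasurable ?_
    filter_upwards [ae_restrict_mem measurableSet_Ioc] with w hw
    have h0 : 0 ≤ w ^ (-(1 / 2) : ℝ) := Real.rpow_nonneg hw.1.le _
    have h1 : 0 < 1 + w := by linarith [hw.1]
    rw [Real.norm_of_nonneg (by positivity)]
    exact mul_le_of_le_one_right h0 (inv_le_one_of_one_le₀ (by linarith [hw.1]))
  · have h : IntegrableOn (fun w : ℝ => w ^ (-(3 / 2) : ℝ)) (Ioi 1) :=
      integrableOn_Ioi_rpow_of_lt (by norm_num) one_pos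
    refine h.mono' hm.aestronglyMeasurable ?_
    filter_upwards [ae_restrict_mem measurableSet_Ioi] with w hw
    have hw' : (0 : ℝ) < w := lt_trans one_pos hw
    have h0 : 0 ≤ w ^ (-(1 / 2) : ℝ) := Real.rpow_nonneg hw'.le _
    rw [Real.norm_of_nonneg (by positivity), show (-(3 / 2) : ℝ) = -(1 / 2) + -1 by norm_num,
      Real.rpow_add hw', Real.rpow_neg_one]
    gcongr
    linarith

theorem integral_eq_zero_of_abel {X : Type*} [NormedAddCommGroup X] [NormedSpace ℝ X]
    [CompleteSpace X] {f : ℝ → X} {C : ℝ} (hf : Continuous f)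
    (hC : ∀ t, 0 < t → ‖f t‖ ≤ C * Real.exp (-t))
    (h0 : ∀ s, 0 < s → ∫ t in Ioi (0 : ℝ), t ^ (-(1 / 2) : ℝ) • f (s + t) = 0) :
    ∫ t in Ioi (0 : ℝ), f t = 0 := by
  set ν : Measure ℝ := volume.restrict (Ioi 0) with hν
  have hpos : ∀ᵐ p ∂ν.prod ν, 0 < p.1 ∧ 0 < p.2 := by
    rw [hν, Measure.prod_restrict]
    filter_upwards [ae_restrict_mem (measurableSet_Ioi.prod measurableSet_Ioi)] with p hp
    exact hp
  have hdom : Integrable (fun p : ℝ × ℝ => p.2 ^ (-(1 / 2) : ℝ) * (C * Real.exp (-(1 + p.2) * p.1)))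
      (ν.prod ν) := by
    have hm : Measurable
        (fun p : ℝ × ℝ => p.2 ^ (-(1 / 2) : ℝ) * (C * Real.exp (-(1 + p.2) * p.1))) := by
      fun_prop
    refine (integrable_prod_iff' hm.aestronglyMeasurable).2 ⟨?_, ?_⟩
    · filter_upwards [ae_restrict_mem measurableSet_Ioi] with w hw
      have hw : (0 : ℝ) < w := hw
      exact ((integrableOn_exp_mul_Ioi (a := -(1 + w)) (by linarith) 0).const_mul _).const_mul _
    · have h3 : IntegrableOn (fun w : ℝ => |C| * (w ^ (-(1 / 2) : ℝ) * (1 + w)⁻¹)) (Ioi 0) :=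
        integrableOn_rpow_mul_inv.const_mul |C|
      refine h3.congr_fun (fun w hw => ?_) measurableSet_Ioi
      have hw : (0 : ℝ) < w := hw
      have h1 : 0 ≤ w ^ (-(1 / 2) : ℝ) := Real.rpow_nonneg hw.le _
      simp only [norm_mul, Real.norm_eq_abs, abs_of_nonneg h1, Real.abs_exp]
      rw [integral_const_mul, integral_const_mul,
        integral_exp_mul_Ioi (by linarith)]
      have : 1 + w ≠ 0 := by linarith
      have h2 : -(1 + w) ≠ 0 := by linarith
      simp only [mul_zero, Real.exp_zero]
      rw [neg_div_neg_eq, one_div]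
      ring
  have hint : Integrable (Function.uncurry fun s w : ℝ => w ^ (-(1 / 2) : ℝ) • f ((1 + w) * s))
      (ν.prod ν) := by
    refine hdom.mono' ?_ ?_
    · have h1 : Measurable fun p : ℝ × ℝ => p.2 ^ (-(1 / 2) : ℝ) := by fun_prop
      have h2 : Continuous fun p : ℝ × ℝ => f ((1 + p.2) * p.1) := by fun_prop
      exact h1.aestronglyMeasurable.smul h2.aestronglyMeasurable
    · filter_upwards [hpos] with p hp
      have h1 : 0 ≤ p.2 ^ (-(1 / 2) : ℝ) := Real.rpow_nonneg hp.2.le _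
      simp only [Function.uncurry]
      rw [norm_smul, Real.norm_of_nonneg h1]
      gcongr
      have := hC ((1 + p.2) * p.1) (mul_pos (by linarith [hp.2]) hp.1)
      rwa [← neg_mul] at this
  have hswap := integral_integral_swap hint
  have hl : ∫ s, ∫ w, w ^ (-(1 / 2) : ℝ) • f ((1 + w) * s) ∂ν ∂ν = 0 := by
    refine integral_eq_zero_of_ae ?_
    filter_upwards [ae_restrict_mem measurableSet_Ioi] with s hs
    have hs : (0 : ℝ) < s := hs
    have h1 := integral_comp_mul_left_Ioi (fun t : ℝ => t ^ (-(1 / 2) : ℝ) • f (s + t)) 0 hs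
    rw [mul_zero, h0 s hs, smul_zero] at h1
    have h2 : ∫ w in Ioi (0 : ℝ), s ^ (-(1 / 2) : ℝ) • (w ^ (-(1 / 2) : ℝ) • f ((1 + w) * s)) = 0 := by
      rw [← h1]
      refine setIntegral_congr_fun measurableSet_Ioi fun w hw => ?_
      rw [Real.mul_rpow hs.le (le_of_lt hw), smul_smul]
      congr 2; ring
    rw [integral_smul] at h2
    exact (smul_eq_zero.1 h2).resolve_left (Real.rpow_pos_of_pos hs _).ne'
  have hr : ∫ w, ∫ s, w ^ (-(1 / 2) : ℝ) • f ((1 + w) * s) ∂ν ∂ν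
      = (∫ w, w ^ (-(1 / 2) : ℝ) * (1 + w)⁻¹ ∂ν) • ∫ t in Ioi (0 : ℝ), f t := by
    rw [← integral_smul_const]
    refine setIntegral_congr_fun measurableSet_Ioi fun w hw => ?_
    have hw : (0 : ℝ) < w := hw
    rw [integral_smul, integral_comp_mul_left_Ioi f 0 (by linarith : 0 < 1 + w), mul_zero, smul_smul]
  rw [hl, hr] at hswap
  refine (smul_eq_zero.1 hswap.symm).resolve_left (ne_of_gt ?_)
  refine (setIntegral_pos_iff_support_of_nonneg_ae ?_ integrableOn_rpow_mul_inv).2 ?_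
  · filter_upwards [ae_restrict_mem measurableSet_Ioi] with w hw
    have hw : (0 : ℝ) < w := hw
    have h1 : 0 ≤ w ^ (-(1 / 2) : ℝ) := Real.rpow_nonneg hw.le _
    simp only [Pi.zero_apply]; positivity
  · have : Ioi (0 : ℝ) ⊆ (Function.support fun w : ℝ => w ^ (-(1 / 2) : ℝ) * (1 + w)⁻¹) ∩ Ioi 0 := by
      intro w hw
      have hw' : (0 : ℝ) < w := hw
      have h1 : 0 < w ^ (-(1 / 2) : ℝ) := Real.rpow_pos_of_pos hw' _
      exact ⟨ne_of_gt (by positivity), hw⟩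
    exact lt_of_lt_of_le (by simp) (measure_mono this)

/-- A strongly continuous, sub-Markovian contraction semigroup `(P_t)_{t ≥ 0}` on `L²(μ)`. -/
structure SubMarkovianSemigroup {E : Type*} [MeasurableSpace E] (μ : Measure E) where
  op : ℝ≥0 → Lp ℝ 2 μ →L[ℝ] Lp ℝ 2 μ
  op_zero : op 0 = ContinuousLinearMap.id ℝ (Lp ℝ 2 μ)
  op_add : ∀ s t, op (s + t) = (op s).comp (op t)
  norm_op_le : ∀ t, ‖op t‖ ≤ 1
  continuous_op : ∀ u, Continuous fun t => op t u
  subMarkov : ∀ t (u : Lp ℝ 2 μ), (∀ᵐ z ∂μ, 0 ≤ u z ∧ u z ≤ 1) →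
    ∀ᵐ z ∂μ, 0 ≤ op t u z ∧ op t u z ≤ 1

namespace SubMarkovianSemigroup

variable {E : Type*} [MeasurableSpace E] {μ : Measure E} (P : SubMarkovianSemigroup μ)

/-- `L u = v` in the sense that `(P_t u - u) / t → v` in `L²(μ)` as `t ↓ 0`. -/
def HasGenerator (u v : Lp ℝ 2 μ) : Prop :=
  Tendsto (fun t : ℝ≥0 => (t : ℝ)⁻¹ • (P.op t u - u)) (𝓝[>] 0) (𝓝 v)

variable {P} in
theorem HasGenerator.add {u v u' v' : Lp ℝ 2 μ} (h : P.HasGenerator u v)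
    (h' : P.HasGenerator u' v') : P.HasGenerator (u + u') (v + v') :=
  (Tendsto.add h h').congr fun t => by rw [map_add, ← smul_add]; congr 1; abel

variable {P} in
theorem HasGenerator.smul {u v : Lp ℝ 2 μ} (c : ℝ) (h : P.HasGenerator u v) :
    P.HasGenerator (c • u) (c • v) :=
  (Tendsto.const_smul h c).congr fun t => by rw [map_smul, smul_comm, smul_sub]

variable {P} in
theorem HasGenerator.unique {u v v' : Lp ℝ 2 μ} (h : P.HasGenerator u v)
    (h' : P.HasGenerator u v') : v = v' :=
  tendsto_nhds_unique h h'

/-- The domain `D(L)` of the generator. -/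
def generatorDomain : Submodule ℝ (Lp ℝ 2 μ) where
  carrier := {u | ∃ v, P.HasGenerator u v}
  add_mem' := fun ⟨v, hv⟩ ⟨v', hv'⟩ => ⟨v + v', hv.add hv'⟩
  zero_mem' := ⟨0, by simp [HasGenerator]⟩
  smul_mem' := fun c _ ⟨v, hv⟩ => ⟨c • v, hv.smul c⟩

/-- The infinitesimal generator `(L, D(L))` of the semigroup, an unbounded operator on `L²(μ)`. -/
def generator : Lp ℝ 2 μ →ₗ.[ℝ] Lp ℝ 2 μ where
  domain := P.generatorDomain
  toFun :=
    { toFun := fun u => Classical.choose u.2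
      map_add' := fun u u' => HasGenerator.unique (Classical.choose_spec (u + u').2)
        ((Classical.choose_spec u.2).add (Classical.choose_spec u'.2))
      map_smul' := fun c u => HasGenerator.unique (Classical.choose_spec (c • u).2)
        ((Classical.choose_spec u.2).smul c) }

theorem hasGenerator_generator (u : P.generator.domain) : P.HasGenerator u (P.generator u) :=
  Classical.choose_spec u.2

/-- The `Γ`-transform `V_r u = Γ(r/2)⁻¹ ∫₀^∞ t^{r/2 - 1} e^{-t} P_t u dt` (a Bochner integral). -/
def gammaTransform (r : ℝ) (u : Lp ℝ 2 μ) : Lp ℝ 2 μ :=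
  (Real.Gamma (r / 2))⁻¹ •
    ∫ t in Ioi (0 : ℝ), (t ^ (r / 2 - 1) * Real.exp (-t)) • P.op t.toNNReal u

theorem norm_op_apply_le (t : ℝ≥0) (u : Lp ℝ 2 μ) : ‖P.op t u‖ ≤ ‖u‖ := by
  simpa using (P.op t).le_of_opNorm_le (P.norm_op_le t) u

theorem continuous_orbit (u : Lp ℝ 2 μ) : Continuous fun t : ℝ => P.op t.toNNReal u :=
  (P.continuous_op u).comp continuous_real_toNNReal

theorem integrableOn_weight {r : ℝ} (hr : 0 < r) :
    IntegrableOn (fun t : ℝ => t ^ (r / 2 - 1) * Real.exp (-t)) (Ioi 0) := by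
  refine (Real.GammaIntegral_convergent (half_pos hr)).congr_fun (fun t _ => mul_comm _ _)
    measurableSet_Ioi

theorem integrableOn_gammaTransform {r : ℝ} (hr : 0 < r) (u : Lp ℝ 2 μ) :
    IntegrableOn (fun t : ℝ => (t ^ (r / 2 - 1) * Real.exp (-t)) • P.op t.toNNReal u) (Ioi 0) := by
  refine Integrable.smul_bdd (C := ‖u‖) (integrableOn_weight hr)
    (P.continuous_orbit u).aestronglyMeasurable (Eventually.of_forall fun t => ?_)
  exact P.norm_op_apply_le _ _

theorem norm_gammaTransform_le {r : ℝ} (hr : 0 < r) (u : Lp ℝ 2 μ) :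
    ‖P.gammaTransform r u‖ ≤ ‖u‖ := by
  have hG : 0 < Real.Gamma (r / 2) := Real.Gamma_pos_of_pos (half_pos hr)
  have h : ‖∫ t in Ioi (0 : ℝ), (t ^ (r / 2 - 1) * Real.exp (-t)) • P.op t.toNNReal u‖
      ≤ ∫ t in Ioi (0 : ℝ), (Real.exp (-t) * t ^ (r / 2 - 1)) * ‖u‖ := by
    refine norm_integral_le_of_norm_le
      ((Real.GammaIntegral_convergent (half_pos hr)).mul_const _) ?_
    filter_upwards [ae_restrict_mem measurableSet_Ioi] with t ht
    have : 0 ≤ t ^ (r / 2 - 1) := Real.rpow_nonneg (le_of_lt ht) _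
    rw [norm_smul, Real.norm_of_nonneg (by positivity), mul_comm (Real.exp _)]
    gcongr
    exact P.norm_op_apply_le _ _
  rw [integral_mul_const, ← Real.Gamma_eq_integral (half_pos hr)] at h
  rw [gammaTransform, norm_smul, norm_inv, Real.norm_of_nonneg hG.le, inv_mul_le_iff₀ hG]
  exact h

/-- `V_1 = (1 - L)^{-1/2}` as a bounded operator on `L²(μ)`. -/
def bessel : Lp ℝ 2 μ →L[ℝ] Lp ℝ 2 μ :=
  LinearMap.mkContinuous
    { toFun := P.gammaTransform 1
      map_add' := fun u v => by
        simp only [gammaTransform, map_add, smul_add]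
        rw [integral_add (P.integrableOn_gammaTransform one_pos u)
          (P.integrableOn_gammaTransform one_pos v), smul_add]
      map_smul' := fun c u => by
        simp only [gammaTransform, map_smul, RingHom.id_apply]
        simp only [smul_comm _ c]
        rw [integral_smul, smul_comm] }
    1 fun u => by simpa using P.norm_gammaTransform_le one_pos u

theorem bessel_apply (u : Lp ℝ 2 μ) : P.bessel u = P.gammaTransform 1 u := rfl

theorem bessel_injective : Function.Injective P.bessel := by
  rw [injective_iff_map_eq_zero]
  intro u hu
  have hI : ∫ t in Ioi (0 : ℝ), (t ^ (-(1 / 2) : ℝ) * Real.exp (-t)) • P.op t.toNNReal u = 0 := by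
    have h := hu
    rw [bessel_apply, gammaTransform, show (1 / 2 - 1 : ℝ) = -(1 / 2) by norm_num] at h
    exact (smul_eq_zero.1 h).resolve_left
      (inv_ne_zero (Real.Gamma_pos_of_pos (by norm_num : (0 : ℝ) < 1 / 2)).ne')
  set f : ℝ → Lp ℝ 2 μ := fun t => Real.exp (-t) • P.op t.toNNReal u with hf
  have hfc : Continuous f := (by fun_prop : Continuous fun t : ℝ => Real.exp (-t)).smul
    (P.continuous_orbit u)
  have hfb : ∀ t, ‖f t‖ ≤ ‖u‖ * Real.exp (-t) := fun t => by
    rw [hf, norm_smul, Real.norm_of_nonneg (Real.exp_pos _).le, mul_comm]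
    gcongr
    exact P.norm_op_apply_le _ _
  have hshift : ∀ a, 0 ≤ a → ∫ t in Ioi (0 : ℝ), t ^ (-(1 / 2) : ℝ) • f (a + t) = 0 := by
    intro a ha
    have h1 := (P.op a.toNNReal).integral_comp_comm
      (P.integrableOn_gammaTransform one_pos u)
    rw [show (1 / 2 - 1 : ℝ) = -(1 / 2) by norm_num, hI, map_zero] at h1
    refine Eq.trans ?_ (smul_zero (Real.exp (-a)))
    rw [← h1, ← integral_smul]
    refine setIntegral_congr_fun measurableSet_Ioi fun t ht => ?_
    have ht : (0 : ℝ) < t := ht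
    simp only [hf]
    rw [Real.toNNReal_add ha ht.le, P.op_add, ContinuousLinearMap.comp_apply, map_smul, smul_smul,
      smul_smul, neg_add, Real.exp_add]
    congr 1; ring
  have htail : ∀ a, 0 ≤ a → ∫ t in Ioi a, f t = 0 := by
    intro a ha
    have h1 : ∫ t in Ioi (0 : ℝ), f (a + t) = 0 := by
      refine integral_eq_zero_of_abel (C := ‖u‖) (f := fun t => f (a + t)) (by fun_prop)
        (fun t ht => (hfb _).trans ?_) fun s hs => ?_
      · gcongr
        linarith
      · simp only [← add_assoc]
        exact hshift (a + s) (by linarith)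
    have h2 := (measurePreserving_add_left volume a).setIntegral_preimage_emb
      (measurableEmbedding_addLeft a) f (Ioi a)
    rw [← h2, ← h1]
    simp
  have hfi : ∀ a, IntegrableOn f (Ioi a) := fun a => by
    refine ((integrableOn_exp_neg_Ioi a).const_mul ‖u‖).mono' hfc.aestronglyMeasurable ?_
    exact Eventually.of_forall hfb
  have hint : ∀ a, 0 ≤ a → ∫ t in (0 : ℝ)..a, f t = 0 := fun a ha => by
    rw [← intervalIntegral.integral_Ioi_sub_Ioi (hfi 0) ha, htail 0 le_rfl, htail a ha, sub_zero]
  have hd : HasDerivWithinAt (fun a => ∫ t in (0 : ℝ)..a, f t) (f 0) (Ici 0) 0 :=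
    (intervalIntegral.integral_hasDerivAt_right (hfc.intervalIntegrable _ _)
      hfc.stronglyMeasurable.stronglyMeasurableAtFilter hfc.continuousAt).hasDerivWithinAt
  have hd' : HasDerivWithinAt (fun a => ∫ t in (0 : ℝ)..a, f t) 0 (Ici 0) 0 :=
    (hasDerivWithinAt_const (0 : ℝ) (Ici 0) (0 : Lp ℝ 2 μ)).congr (fun a ha => hint a ha)
      (hint 0 le_rfl)
  have h0 := (uniqueDiffWithinAt_Ici (0 : ℝ)).eq_deriv _ hd hd'
  simpa [hf, P.op_zero] using h0

/-- The space `F_{1,2} = V_1(L²(μ))`. -/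
def F12 : Type _ := LinearMap.range P.bessel.toLinearMap

namespace F12

/-- The bijection `V_1` from `L²(μ)` onto its range. -/
def rangeEquiv : Lp ℝ 2 μ ≃ₗ[ℝ] LinearMap.range P.bessel.toLinearMap :=
  LinearEquiv.ofInjective P.bessel.toLinearMap P.bessel_injective

/-- The norm of `F_{1,2}` is `‖V_1 u‖ = |u|₂`. -/
instance : NormedAddCommGroup P.F12 :=
  NormedAddCommGroup.induced (LinearMap.range P.bessel.toLinearMap) (Lp ℝ 2 μ)
    (rangeEquiv P).symm.toLinearMap (rangeEquiv P).symm.injective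

/-- The inner product of `F_{1,2}` is `⟨V_1 u, V_1 v⟩ = ⟨u, v⟩₂`. -/
instance : InnerProductSpace ℝ P.F12 :=
  InnerProductSpace.induced (G := LinearMap.range P.bessel.toLinearMap)
    (rangeEquiv P).symm.toLinearMap

/-- The bijection `V_1 : L²(μ) → F_{1,2}`. -/
def besselEquiv : Lp ℝ 2 μ ≃ₗ[ℝ] P.F12 := rangeEquiv P

theorem norm_eq (f : P.F12) : ‖f‖ = ‖(besselEquiv P).symm f‖ := rfl

theorem inner_eq (f g : P.F12) :
    inner ℝ f g = inner ℝ ((besselEquiv P).symm f) ((besselEquiv P).symm g) := rfl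

/-- The inclusion `F_{1,2} ⊂ L²(μ)`. -/
def incl : P.F12 →L[ℝ] Lp ℝ 2 μ :=
  LinearMap.mkContinuous (LinearMap.range P.bessel.toLinearMap).subtype 1 fun f => by
    obtain ⟨u, rfl⟩ := (besselEquiv P).surjective f
    rw [norm_eq, LinearEquiv.symm_apply_apply, one_mul]
    exact P.norm_gammaTransform_le one_pos u

theorem incl_besselEquiv (u : Lp ℝ 2 μ) : incl P (besselEquiv P u) = P.bessel u := rfl

end F12

/-- The dual space `F*_{1,2}` of `F_{1,2}`, with the dual norm. Since `u ↦ V_1 u` is an isometry of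
`L²(μ)` onto `F_{1,2}` and `V_1² = (1 - L)⁻¹`, this is `‖η‖ = ⟨η, (1 - L)⁻¹ η⟩^{1/2}`. -/
def F12Dual : Type _ := StrongDual ℝ P.F12

namespace F12Dual

instance : NormedAddCommGroup P.F12Dual := inferInstanceAs (NormedAddCommGroup (StrongDual ℝ P.F12))

instance : NormedSpace ℝ P.F12Dual := inferInstanceAs (NormedSpace ℝ (StrongDual ℝ P.F12))

instance : CompleteSpace P.F12Dual := inferInstanceAs (CompleteSpace (StrongDual ℝ P.F12))

/-- An element of `F*_{1,2}`, regarded as a bounded linear functional on `F_{1,2}`. -/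
def functional : P.F12Dual ≃ₗᵢ[ℝ] StrongDual ℝ P.F12 := LinearIsometryEquiv.refl ℝ (StrongDual ℝ P.F12)

end F12Dual

/-- The embedding `L²(μ) ⊂ F*_{1,2}` of the triple `F_{1,2} ⊂ L²(μ) ≡ (L²(μ))* ⊂ F*_{1,2}`: the
function `u` acts as `f ↦ ⟨u, f⟩₂`. -/
def embed : Lp ℝ 2 μ →L[ℝ] P.F12Dual :=
  (F12Dual.functional P).symm.toContinuousLinearEquiv.toContinuousLinearMap ∘L
    (ContinuousLinearMap.compL ℝ P.F12 (Lp ℝ 2 μ) ℝ).flip (F12.incl P) ∘L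
      (innerSL ℝ : Lp ℝ 2 μ →L[ℝ] Lp ℝ 2 μ →L[ℝ] ℝ)

theorem embed_apply (u : Lp ℝ 2 μ) (f : P.F12) :
    F12Dual.functional P (P.embed u) f = inner ℝ u (F12.incl P f) := rfl

/-- The Riesz isomorphism `f ↦ ⟨f, ·⟩_{F_{1,2}}` of `F_{1,2}` onto `F*_{1,2}`; this is the operator
`1 - L : F_{1,2} → F*_{1,2}`, whose inverse is `(1 - L)⁻¹`. -/
def riesz : P.F12 →L[ℝ] P.F12Dual :=
  (F12Dual.functional P).symm.toContinuousLinearEquiv.toContinuousLinearMap ∘L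
    (innerSL ℝ : P.F12 →L[ℝ] P.F12 →L[ℝ] ℝ)

theorem riesz_apply (f g : P.F12) : F12Dual.functional P (P.riesz f) g = inner ℝ f g := rfl

/-- The operator `L = 1 - (1 - L) : F_{1,2} → F*_{1,2}`, i.e.
`(L f)(g) = ⟨f, g⟩₂ - ⟨f, g⟩_{F_{1,2}}`. When the generator is self-adjoint, this is the continuous
extension of the generator from `D(L)` to `F_{1,2}`. -/
def extL : P.F12 →L[ℝ] P.F12Dual := P.embed ∘L F12.incl P - P.riesz

theorem extL_apply (f g : P.F12) :
    F12Dual.functional P (P.extL f) g = inner ℝ (F12.incl P f) (F12.incl P g) - inner ℝ f g := rfl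

end SubMarkovianSemigroup

/-- The Hilbert-Schmidt norm `(∑ ‖A e_i‖²)^{1/2} ∈ [0, ∞]` of a bounded operator, computed in an
orthonormal basis of the domain (the value does not depend on the basis when the target carries a
Hilbert norm, as `F*_{1,2}` does). The operator is Hilbert-Schmidt iff this is finite. -/
def hsNorm {H₁ H₂ : Type*} [NormedAddCommGroup H₁] [InnerProductSpace ℝ H₁] [CompleteSpace H₁]
    [NormedAddCommGroup H₂] [NormedSpace ℝ H₂] (A : H₁ →L[ℝ] H₂) : ℝ≥0∞ :=
  (∑' e : (exists_hilbertBasis ℝ H₁).choose, ‖A e‖ₑ ^ 2) ^ (1 / 2 : ℝ)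

section Skeleton

variable {E : Type*} [MeasurableSpace E] {μ : Measure E} (P : SubMarkovianSemigroup μ)

/-- The assumptions on the noise coefficient `B : [0,T] × L²(μ) → L_2(L²(μ), F*_{1,2})`:
Lipschitz continuity and linear growth in the second variable with respect to the
`F*_{1,2}`-norm, and Hölder continuity in time. The growth bound contains the assertion that every
`B t u` is Hilbert-Schmidt. -/
structure NoiseCoefficient (T : ℝ)
    (B : ℝ → Lp ℝ 2 μ → (Lp ℝ 2 μ →L[ℝ] P.F12Dual)) : Prop where
  lipschitz : ∃ C₁ : ℝ, 0 ≤ C₁ ∧ ∀ t ∈ Icc 0 T, ∀ u v,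
    hsNorm (B t u - B t v) ≤ ENNReal.ofReal (C₁ * ‖P.embed u - P.embed v‖)
  growth : ∃ C₂ : ℝ, 0 < C₂ ∧ ∀ t ∈ Icc 0 T, ∀ u,
    hsNorm (B t u) ≤ ENNReal.ofReal (C₂ * (‖P.embed u‖ + 1))
  holder : ∃ γ : ℝ, 0 < γ ∧ ∃ C : ℝ, 0 ≤ C ∧ ∀ t₁ ∈ Icc 0 T, ∀ t₂ ∈ Icc 0 T, ∀ u,
    hsNorm (B t₁ u - B t₂ u) ≤ ENNReal.ofReal (C * (‖P.embed u‖ + 1) * |t₁ - t₂| ^ γ)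

/-- The space `L²([0,T]; L²(μ))`. -/
abbrev L2Path (T : ℝ) (μ : Measure E) : Type _ :=
  Lp (Lp ℝ 2 μ) 2 ((volume : Measure ℝ).restrict (Icc 0 T))

/-- `S_M = {h ∈ L²([0,T]; L²(μ)) : ∫₀ᵀ |h(s)|₂² ds ≤ M}`. -/
def controlBall (T : ℝ) (μ : Measure E) (M : ℝ) : Set (L2Path T μ) :=
  {h | ∫ s in (0 : ℝ)..T, ‖h s‖ ^ 2 ≤ M}

/-- `Y` is a solution of the skeleton equation
`dY(t) - L Ψ(Y(t)) dt = B(t, Y(t)) ∘ h(t) dt`, `Y(0) = x`, on `[0,T]`: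
`Y ∈ C([0,T]; F*_{1,2}) ∩ L²([0,T]; L²(μ))` (`y` is `Y` regarded as an element of
`L²([0,T]; L²(μ))`), `∫₀^· Ψ(Y(s)) ds ∈ C([0,T]; F_{1,2})` (this path is `Z`), and
`Y(t) - L ∫₀ᵗ Ψ(Y(s)) ds = x + ∫₀ᵗ B(s, Y(s)) ∘ h(s) ds` in `F*_{1,2}` for all `t ∈ [0,T]`, where
the last integral is a Bochner integral in `F*_{1,2}`. Here `Ψ(u)` is the composition `Ψ ∘ u`,
which is in `L²(μ)` because `Ψ` is Lipschitz with `Ψ 0 = 0`. -/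
def IsSkeletonSolution {Ψ : ℝ → ℝ} {K : ℝ≥0} (hΨ : LipschitzWith K Ψ) (hΨ0 : Ψ 0 = 0)
    (T : ℝ) (B : ℝ → Lp ℝ 2 μ → (Lp ℝ 2 μ →L[ℝ] P.F12Dual)) (x : P.F12Dual)
    (h : L2Path T μ) (Y : C(Icc 0 T, P.F12Dual)) : Prop :=
  ∃ (y : L2Path T μ) (Z : C(Icc 0 T, P.F12)),
    (∀ᵐ s : ℝ, ∀ hs : s ∈ Icc 0 T, Y ⟨s, hs⟩ = P.embed (y s)) ∧
    (∀ t : Icc 0 T,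
      SubMarkovianSemigroup.F12.incl P (Z t) = ∫ s in (0 : ℝ)..t, hΨ.compLp hΨ0 (y s)) ∧
    IntegrableOn (fun s => B s (y s) (h s)) (Icc 0 T) ∧
    ∀ t : Icc 0 T,
      Y t - P.extL (Z t) = x + ∫ s in (0 : ℝ)..t, B s (y s) (h s)

end Skeleton

end

/-! Let `i` be the inclusion of `F_{1,2}` in `L²(μ)`. After the Riesz identification `J` of the dual
with `F_{1,2}`, the embedding of `L²(μ)` becomes `i*` and `L` becomes `i* i - 1`. The difference
`D_n = J (Y_n - Y)` then solves an equation in an abstract Hilbert triple, with drift `ψ_n = Ψ(y_n)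
- Ψ(y)`, density `d_n = y_n - y` and a force `g_n`.

The drift is harmless. Since `Ψ` is monotone and Lipschitz, `‖ψ_n‖² ≤ κ ⟨ψ_n, d_n⟩`, so the energy
equality for `‖D_n‖²` yields a good term in `‖ψ_n‖²` at the cost of a multiple of `‖D_n‖²`
(`IsTriplePath.norm_sq_eq`, `IsTriplePath.norm_sq_add_le`). The energy equality is obtained by
regularising the quadratic form with the resolvents of `i i*`, because `ψ_n` takes values in `L²(μ)`
only and `D_n` need not be absolutely continuous in `F_{1,2}`.

The force splits as `g_n = J (B(s, y_n) - B(s, y)) h_n + β(s) k_n`, with `β(s) = J B(s, y(s))` and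
`k_n = h_n - h`. The first term is at most `C₁ ‖D_n‖ ‖h_n‖`, which Grönwall's inequality absorbs
because the `h_n` are bounded in `L²`. It remains to show that `∫₀ᵗ ⟨β k_n, D_n⟩` tends to zero
uniformly in `t`, although `k_n` is only weakly null and `D_n` varies with `n`.

The operators `β(s)` are Hilbert–Schmidt, hence norm limits of sums of operators `⟨f, ·⟩ i* u`. For
one of these the integrand is `⟨f, k_n⟩ ⟨i* u, D_n⟩`, whose second factor is Hölder of exponent 1/2
uniformly in `n` (`IsControlledFamily.exists_holder`). It may therefore be frozen on short
intervals, where weak convergence of `k_n` applies. Uniform continuity of `s ↦ β(s)` on a set of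
full measure allows `β` to be frozen as well. Each of these replacements is an instance of
`tendsto_integral_of_local_approx`. Equicontinuity in `t` upgrades pointwise to uniform convergence,
and Grönwall's inequality concludes (`IsControlledFamily.eventually_norm_le`). -/

/-! ### Resolvents and regularisation in a Hilbert triple -/

/-- The resolvent of a positive symmetric operator. -/
theorem exists_resolvent {U : Type*} [NormedAddCommGroup U] [InnerProductSpace ℝ U]
    [CompleteSpace U] (c : U →L[ℝ] U) (hc : ∀ u, 0 ≤ inner ℝ (c u) u)
    (hs : ∀ u v, inner ℝ (c u) v = inner ℝ u (c v)) {ε : ℝ} (hε : 0 < ε) :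
    ∃ N : U →L[ℝ] U, (∀ u, ε • N u + c (N u) = u) ∧ (∀ u, N (c u) = c (N u)) ∧
      (∀ u, ‖ε • N u‖ ≤ ‖u‖) ∧ ∀ u v, inner ℝ (N u) v = inner ℝ u (N v) := by
  set A : U →L[ℝ] U := ε • ContinuousLinearMap.id ℝ U + c with hA
  have hAu : ∀ u, A u = ε • u + c u := fun u => rfl
  -- Lax–Milgram inverts `ε + c`: positivity of `c` leaves `ε` as coercivity constant.
  have hco : IsCoercive ((innerSL ℝ : U →L[ℝ] U →L[ℝ] ℝ) ∘L A) := by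
    refine ⟨ε, hε, fun u => ?_⟩
    have : ((innerSL ℝ : U →L[ℝ] U →L[ℝ] ℝ) ∘L A) u u = inner ℝ (A u) u := rfl
    rw [this, hAu, inner_add_left, real_inner_smul_left, real_inner_self_eq_norm_mul_norm]
    nlinarith [hc u]
  set Q := hco.continuousLinearEquivOfBilin with hQ
  have hQA : ∀ u, Q u = A u := fun u => by
    refine ext_inner_right ℝ fun w => ?_
    rw [hQ, hco.continuousLinearEquivOfBilin_apply]; rfl
  set N : U →L[ℝ] U := (Q.symm : U →L[ℝ] U) with hN
  have h1 : ∀ u, A (N u) = u := fun u => by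
    rw [← hQA]; exact Q.apply_symm_apply u
  have h1' : ∀ u, N (A u) = u := fun u => by
    rw [← hQA]; exact Q.symm_apply_apply u
  have hsA : ∀ u v, inner ℝ (A u) v = inner ℝ u (A v) := fun u v => by
    rw [hAu, hAu, inner_add_left, inner_add_right, real_inner_smul_left, real_inner_smul_right, hs]
  refine ⟨N, h1, fun u => ?_, fun u => ?_, fun u v => ?_⟩
  · have h2 := h1' u
    have h3 := h1 u
    rw [hAu] at h2 h3
    rw [map_add, map_smul] at h2
    exact add_left_cancel (h2.trans h3.symm)
  · have h3 := h1 u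
    rw [hAu] at h3
    have h4 : ‖ε • N u‖ * ‖ε • N u‖ ≤ ‖u‖ * ‖ε • N u‖ := by
      rw [← real_inner_self_eq_norm_mul_norm]
      refine le_trans ?_ (real_inner_le_norm u (ε • N u))
      nth_rewrite 3 [← h3]
      rw [inner_add_left, real_inner_smul_right (c (N u))]
      linarith [mul_nonneg hε.le (hc (N u))]
    by_contra! h5
    have := norm_nonneg u
    nlinarith
  · rw [← h1 v, ← hsA, h1, h1]

theorem tendsto_of_dense {X Y : Type*} [NormedAddCommGroup X] [NormedSpace ℝ X]
    [NormedAddCommGroup Y] [NormedSpace ℝ Y] (A : ℕ → X →L[ℝ] Y) (B : X →L[ℝ] Y) (C : ℝ)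
    (hC : ∀ n x, ‖A n x‖ ≤ C * ‖x‖) {ι : Type*} {f : ι → X} (hf : DenseRange f)
    (h : ∀ j, Tendsto (fun n => A n (f j)) atTop (𝓝 (B (f j)))) (x : X) :
    Tendsto (fun n => A n x) atTop (𝓝 (B x)) := by
  rw [Metric.tendsto_atTop]
  intro ε hε
  have hK : 0 < |C| + ‖B‖ + 1 := by positivity
  obtain ⟨j, hj⟩ := Metric.denseRange_iff.1 hf x (ε / 2 / (|C| + ‖B‖ + 1)) (by positivity)
  obtain ⟨n₀, hn₀⟩ := Metric.tendsto_atTop.1 (h j) (ε / 2) (by positivity)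
  refine ⟨n₀, fun n hn => ?_⟩
  have h1 := hn₀ n hn
  rw [dist_eq_norm] at h1 hj ⊢
  have h2 : A n x - B x = A n (x - f j) + (A n (f j) - B (f j)) - B (x - f j) := by
    simp only [map_sub]; abel
  have h3 : ‖A n (x - f j)‖ ≤ |C| * ‖x - f j‖ :=
    (hC n _).trans (by gcongr; exact le_abs_self C)
  have h4 : ‖B (x - f j)‖ ≤ ‖B‖ * ‖x - f j‖ := B.le_opNorm _
  rw [lt_div_iff₀ hK] at hj
  rw [h2]
  refine (norm_sub_le _ _).trans_lt ((add_le_add_left (norm_add_le _ _) _).trans_lt ?_)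
  nlinarith [norm_nonneg (x - f j)]

section Triple

variable {F U : Type*} [NormedAddCommGroup F] [InnerProductSpace ℝ F] [CompleteSpace F]
  [NormedAddCommGroup U] [InnerProductSpace ℝ U] [CompleteSpace U]

/-- The orthogonal complement of the range of `i*` is the kernel of `i`. This is what lets an
arbitrary vector of `F` be replaced by some `i* u`, against which paths can be tested in `U`. -/
theorem denseRange_adjoint {i : F →L[ℝ] U} (hi : Function.Injective i) :
    DenseRange (ContinuousLinearMap.adjoint i) := by
  have h : ((ContinuousLinearMap.adjoint i).range).topologicalClosure = ⊤ := by
    rw [Submodule.topologicalClosure_eq_top_iff, Submodule.eq_bot_iff]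
    intro f hf
    refine hi ?_
    rw [map_zero]
    refine ext_inner_left ℝ fun u => ?_
    rw [inner_zero_right, ← ContinuousLinearMap.adjoint_inner_left]
    exact hf _ ⟨u, rfl⟩
  rw [← Submodule.dense_iff_topologicalClosure_eq_top] at h
  exact h

/-- Regularising operators `N n = (1 / (n + 1) + i i*)⁻¹` of a triple given by `i : F → U`. -/
theorem exists_regularization {i : F →L[ℝ] U} (hi : Function.Injective i) (hd : DenseRange i) :
    ∃ N : ℕ → U →L[ℝ] U, (∀ n u v, inner ℝ (N n u) v = inner ℝ u (N n v)) ∧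
      (∀ n u, ‖i (ContinuousLinearMap.adjoint i (N n u))‖ ≤ 2 * ‖u‖) ∧
      (∀ u, Tendsto (fun n => i (ContinuousLinearMap.adjoint i (N n u))) atTop (𝓝 u)) ∧
      (∀ n f, ‖ContinuousLinearMap.adjoint i (N n (i f))‖ ≤ ‖f‖) ∧
      ∀ f, Tendsto (fun n => ContinuousLinearMap.adjoint i (N n (i f))) atTop (𝓝 f) := by
  set e := ContinuousLinearMap.adjoint i with he
  have hei : ∀ u f, inner ℝ (e u) f = inner ℝ u (i f) := fun u f =>
    ContinuousLinearMap.adjoint_inner_left i f u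
  have hie : ∀ u f, inner ℝ f (e u) = inner ℝ (i f) u := fun u f =>
    ContinuousLinearMap.adjoint_inner_right i f u
  have hε : ∀ n : ℕ, 0 < (1 : ℝ) / ((n : ℝ) + 1) := fun n => by positivity
  choose N hN1 hN2 hN3 hN4 using fun n : ℕ => exists_resolvent (i ∘L e)
    (fun u => by
      rw [ContinuousLinearMap.comp_apply, ← hie]; exact real_inner_self_nonneg)
    (fun u v => by
      rw [ContinuousLinearMap.comp_apply, ContinuousLinearMap.comp_apply, ← hie, hei])
    (hε n)
  simp only [ContinuousLinearMap.comp_apply] at hN1 hN2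
  have hde : DenseRange e := denseRange_adjoint hi
  have hb : ∀ n u, ‖i (e (N n u))‖ ≤ 2 * ‖u‖ := fun n u => by
    have h1 : i (e (N n u)) = u - ((1 : ℝ) / ((n : ℝ) + 1)) • N n u :=
      eq_sub_of_add_eq' (hN1 n u)
    rw [h1]
    linarith [norm_sub_le u (((1 : ℝ) / ((n : ℝ) + 1)) • N n u), hN3 n u]
  -- On the dense range of `i e` the error is `-(1 / (n + 1)) i e N w`, which is `O(1 / n)` by the
  -- uniform bound.
  have hc : ∀ u, Tendsto (fun n => i (e (N n u))) atTop (𝓝 u) := by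
    intro u
    refine tendsto_of_dense (fun n => i ∘L e ∘L N n) (ContinuousLinearMap.id ℝ U) 2 hb
      (f := fun w : U => i (e w)) (hd.comp hde i.continuous) (fun w => ?_) u
    simp only [ContinuousLinearMap.comp_apply, ContinuousLinearMap.id_apply]
    rw [tendsto_iff_norm_sub_tendsto_zero]
    have h1 : Tendsto (fun n : ℕ => 1 / ((n : ℝ) + 1) * (2 * ‖w‖)) atTop (𝓝 0) := by
      simpa using tendsto_one_div_add_atTop_nhds_zero_nat.mul_const (2 * ‖w‖)
    refine squeeze_zero (fun n => norm_nonneg _) (fun n => ?_) h1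
    have h2 : i (e (N n (i (e w)))) - i (e w)
        = -(((1 : ℝ) / ((n : ℝ) + 1)) • i (e (N n w))) := by
      have := hN1 n (i (e w))
      rw [hN2 n w] at this ⊢
      rw [← this]
      abel
    rw [h2, norm_neg, norm_smul, Real.norm_of_nonneg (hε n).le]
    gcongr
    exact hb n w
  -- `‖e N i f‖² = ⟨i e N i f, N i f⟩ ≤ ⟨i f, N i f⟩ = ⟨f, e N i f⟩`, since `i f` exceeds `i e N i
  -- f` by a nonnegative multiple of `N i f`.
  have hb' : ∀ n f, ‖e (N n (i f))‖ ≤ ‖f‖ := fun n f => by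
    have h1 : ‖e (N n (i f))‖ * ‖e (N n (i f))‖ ≤ ‖f‖ * ‖e (N n (i f))‖ := by
      rw [← real_inner_self_eq_norm_mul_norm]
      refine le_trans ?_ (real_inner_le_norm f (e (N n (i f))))
      rw [hie, hie]
      nth_rewrite 3 [← hN1 n (i f)]
      rw [inner_add_left, real_inner_smul_left]
      have := mul_nonneg (hε n).le (real_inner_self_nonneg (x := N n (i f)))
      linarith
    by_contra! h5
    have := norm_nonneg f
    nlinarith
  refine ⟨N, hN4, hb, hc, hb', fun f => ?_⟩
  refine tendsto_of_dense (fun n => e ∘L N n ∘L i) (ContinuousLinearMap.id ℝ F) 1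
    (fun n f => by simpa using hb' n f) hde (fun w => ?_) f
  simp only [ContinuousLinearMap.comp_apply, ContinuousLinearMap.id_apply, hN2]
  exact (e.continuous.tendsto w).comp (by simpa [hN2] using hc w)

end Triple

/-! ### Calculus tools: chain rule, Cauchy–Schwarz, Grönwall -/

theorem AbsolutelyContinuousOnInterval.of_dist_le {X Y : Type*} [PseudoMetricSpace X]
    [PseudoMetricSpace Y] {f : ℝ → X} {g : ℝ → Y} {a b : ℝ}
    (hg : AbsolutelyContinuousOnInterval g a b)
    (h : ∀ x ∈ uIcc a b, ∀ y ∈ uIcc a b, dist (f x) (f y) ≤ dist (g x) (g y)) :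
    AbsolutelyContinuousOnInterval f a b := by
  rw [absolutelyContinuousOnInterval_iff] at hg ⊢
  intro ε hε
  obtain ⟨δ, hδ, H⟩ := hg ε hε
  refine ⟨δ, hδ, fun E hE hlt => lt_of_le_of_lt (Finset.sum_le_sum fun j hj => ?_) (H E hE hlt)⟩
  exact h _ (hE.1 j hj).1 _ (hE.1 j hj).2

/-- The chain rule for a quadratic form along an absolutely continuous Hilbert space valued path. -/
theorem integral_inner_symmetric_primitive {U : Type*} [NormedAddCommGroup U]
    [InnerProductSpace ℝ U] [CompleteSpace U] (N : U →L[ℝ] U)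
    (hN : ∀ u v, inner ℝ (N u) v = inner ℝ u (N v)) {ξ : ℝ → U} {a b : ℝ}
    (hξ : IntervalIntegrable ξ volume a b) :
    2 * ∫ t in a..b, inner ℝ (N (ξ t)) (∫ s in a..t, ξ s)
      = inner ℝ (N (∫ s in a..b, ξ s)) (∫ s in a..b, ξ s) := by
  set X : ℝ → U := fun t => ∫ s in a..t, ξ s with hX
  -- The variation `V` dominates the increments of `X`, hence, up to a constant, those of the scalar
  -- function `⟨N X, X⟩`. The latter is thus absolutely continuous, and the fundamental theorem is
  -- needed for real functions only.
  set V : ℝ → ℝ := fun t => ∫ s in a..t, ‖ξ s‖ with hV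
  have hac : AbsolutelyContinuousOnInterval V a b :=
    hξ.norm.absolutelyContinuousOnInterval_intervalIntegral left_mem_uIcc
  have hii : ∀ x ∈ uIcc a b, ∀ y ∈ uIcc a b, IntervalIntegrable ξ volume x y :=
    fun x hx y hy => hξ.mono_set (uIcc_subset_uIcc hx hy)
  have hXd : ∀ x ∈ uIcc a b, ∀ y ∈ uIcc a b, dist (X x) (X y) ≤ dist (V x) (V y) := by
    intro x hx y hy
    rw [dist_eq_norm, dist_eq_norm, hX, hV]
    simp only
    rw [intervalIntegral.integral_interval_sub_left (hii a left_mem_uIcc x hx)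
      (hii a left_mem_uIcc y hy), intervalIntegral.integral_interval_sub_left
      (hii a left_mem_uIcc x hx).norm (hii a left_mem_uIcc y hy).norm]
    exact intervalIntegral.norm_integral_le_abs_integral_norm
  obtain ⟨R, hR⟩ := (hac.of_dist_le hXd).exists_bound
  have hR0 : 0 ≤ R := (norm_nonneg _).trans (hR a left_mem_uIcc)
  have hqac : AbsolutelyContinuousOnInterval (fun t => inner ℝ (N (X t)) (X t)) a b := by
    refine (hac.const_mul (2 * ‖N‖ * R)).of_dist_le fun x hx y hy => ?_
    have h1 : inner ℝ (N (X x)) (X x) - inner ℝ (N (X y)) (X y)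
        = inner ℝ (N (X x - X y)) (X x) + inner ℝ (N (X y)) (X x - X y) := by
      rw [map_sub, inner_sub_left, inner_sub_right]; ring
    have hc : 0 ≤ 2 * ‖N‖ * R := by positivity
    rw [Real.dist_eq, h1, Real.dist_eq, ← mul_sub, abs_mul, abs_of_nonneg hc, ← Real.dist_eq]
    have h2 : ‖X x - X y‖ ≤ dist (V x) (V y) := by
      rw [← dist_eq_norm]; exact hXd x hx y hy
    calc |inner ℝ (N (X x - X y)) (X x) + inner ℝ (N (X y)) (X x - X y)|
        ≤ ‖N‖ * ‖X x - X y‖ * R + ‖N‖ * R * ‖X x - X y‖ := by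
          refine (abs_add_le _ _).trans (add_le_add ?_ ?_)
          · refine (abs_real_inner_le_norm _ _).trans ?_
            gcongr
            · exact N.le_opNorm _
            · exact hR x hx
          · refine (abs_real_inner_le_norm _ _).trans ?_
            gcongr
            exact (N.le_opNorm _).trans (by gcongr; exact hR y hy)
      _ = 2 * ‖N‖ * R * ‖X x - X y‖ := by ring
      _ ≤ _ := by gcongr
  have h := hqac.integral_deriv_eq_sub
  have h0 : X a = 0 := intervalIntegral.integral_same
  simp only [h0, map_zero, inner_zero_left, sub_zero] at h
  rw [← intervalIntegral.integral_const_mul, ← h]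
  refine intervalIntegral.integral_congr_ae ?_
  filter_upwards [hξ.ae_hasDerivAt_integral] with t ht htm
  have hd := ht (uIoc_subset_uIcc htm) a left_mem_uIcc
  have hd2 : HasDerivAt (fun t => N (X t)) (N (ξ t)) t := N.hasFDerivAt.comp_hasDerivAt t hd
  rw [(hd2.inner ℝ hd).deriv, hN (X t), real_inner_comm (N (ξ t)) (X t)]
  ring

theorem sq_integral_mul_le {α : Type*} [MeasurableSpace α] {ν : Measure α} {f g : α → ℝ}
    (hf : MemLp f 2 ν) (hg : MemLp g 2 ν) :
    (∫ s, f s * g s ∂ν) ^ 2 ≤ (∫ s, f s ^ 2 ∂ν) * ∫ s, g s ^ 2 ∂ν := by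
  have h1 : ∀ x : ℝ, 0 ≤ (∫ s, f s ^ 2 ∂ν) * (x * x) + (2 * ∫ s, f s * g s ∂ν) * x
      + ∫ s, g s ^ 2 ∂ν := by
    intro x
    have h2 : ∫ s, (x * f s + g s) ^ 2 ∂ν
        = (∫ s, f s ^ 2 ∂ν) * (x * x) + (2 * ∫ s, f s * g s ∂ν) * x + ∫ s, g s ^ 2 ∂ν := by
      have e : ∀ s, (x * f s + g s) ^ 2 = (x * x) * f s ^ 2 + (2 * x) * (f s * g s) + g s ^ 2 :=
        fun s => by ring
      simp only [e]
      have i1 : Integrable (fun s => x * x * f s ^ 2) ν := hf.integrable_sq.const_mul _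
      have i2 : Integrable (fun s => 2 * x * (f s * g s)) ν := (hf.integrable_mul hg).const_mul _
      have i3 : Integrable (fun s => x * x * f s ^ 2 + 2 * x * (f s * g s)) ν := i1.add i2
      rw [integral_add i3 hg.integrable_sq, integral_add i1 i2, integral_const_mul,
        integral_const_mul]
      ring
    rw [← h2]
    exact integral_nonneg fun s => sq_nonneg _
  have := discrim_le_zero h1
  rw [discrim] at this
  nlinarith

theorem Continuous.memLp_restrict_Icc {X : Type*} [NormedAddCommGroup X] {f : ℝ → X}
    (hf : Continuous f) (a b : ℝ) (p : ℝ≥0∞) : MemLp f p (volume.restrict (Icc a b)) := by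
  obtain ⟨C, hC⟩ := isCompact_Icc.exists_bound_of_continuousOn (hf.continuousOn (s := Icc a b))
  refine MemLp.of_bound ?_ C ?_
  · exact hf.continuousOn.aestronglyMeasurable_of_isCompact isCompact_Icc measurableSet_Icc
  · filter_upwards [ae_restrict_mem measurableSet_Icc] with s hs using hC s hs

theorem restrict_Ioc_le_restrict_Icc {a b c d : ℝ} (hca : c ≤ a) (hbd : b ≤ d) :
    volume.restrict (Ioc a b) ≤ (volume.restrict (Icc c d) : Measure ℝ) :=
  Measure.restrict_mono (Ioc_subset_Icc_self.trans (Icc_subset_Icc hca hbd)) le_rfl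

theorem MeasureTheory.Integrable.intervalIntegrable_of_mem {X : Type*} [NormedAddCommGroup X]
    {f : ℝ → X} {T : ℝ} (hf : Integrable f (volume.restrict (Icc 0 T))) {a b : ℝ}
    (ha : a ∈ Icc 0 T) (hb : b ∈ Icc 0 T) : IntervalIntegrable f volume a b := by
  rw [intervalIntegrable_iff]
  exact hf.mono_measure (Measure.restrict_mono
    (uIoc_subset_uIcc.trans (uIcc_subset_Icc ha hb)) le_rfl)

theorem intervalIntegral_le_integral_Icc {T : ℝ} {f : ℝ → ℝ} (h0 : ∀ s, 0 ≤ f s)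
    (hf : Integrable f (volume.restrict (Icc 0 T))) {a b : ℝ} (ha : 0 ≤ a) (hab : a ≤ b)
    (hb : b ≤ T) : ∫ s in a..b, f s ≤ ∫ s in Icc 0 T, f s := by
  rw [intervalIntegral.integral_of_le hab]
  exact integral_mono_measure (restrict_Ioc_le_restrict_Icc ha hb) (Eventually.of_forall h0) hf

/-- Grönwall's inequality with a square integrable coefficient. -/
theorem sq_le_of_le_add_integral_mul {T A R : ℝ} {φ k : ℝ → ℝ} (hφ : Continuous φ)
    (hk : MemLp k 2 (volume.restrict (Icc 0 T))) (hR : 0 < R)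
    (hkR : ∫ s in Icc 0 T, k s ^ 2 ≤ R) (h0 : ∀ t ∈ Icc 0 T, 0 ≤ φ t)
    (h : ∀ t ∈ Icc 0 T, φ t ≤ A + ∫ s in (0 : ℝ)..t, k s * φ s) :
    ∀ t ∈ Icc 0 T, φ t ^ 2 ≤ 2 * A ^ 2 * Real.exp (2 * R * T) := by
  set J : ℝ → ℝ := fun t => ∫ s in (0 : ℝ)..t, φ s ^ 2 with hJ
  have hJd : ∀ t, HasDerivAt J (φ t ^ 2) t := fun t =>
    intervalIntegral.integral_hasDerivAt_right ((hφ.pow 2).intervalIntegrable _ _)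
      (hφ.pow 2).stronglyMeasurable.stronglyMeasurableAtFilter (hφ.pow 2).continuousAt
  -- Squaring and Cauchy–Schwarz trade the square integrable coefficient for the constant `2 * R`,
  -- so that the classical Grönwall inequality applies to `J`.
  have hb : ∀ t ∈ Icc 0 T, φ t ^ 2 ≤ 2 * R * J t + 2 * A ^ 2 := by
    intro t ht
    have hm := restrict_Ioc_le_restrict_Icc (le_refl 0) ht.2
    have hcs := sq_integral_mul_le (hk.mono_measure hm)
      ((hφ.memLp_restrict_Icc 0 T 2).mono_measure hm)
    rw [← intervalIntegral.integral_of_le ht.1, ← intervalIntegral.integral_of_le ht.1,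
      ← intervalIntegral.integral_of_le ht.1] at hcs
    have h1 := intervalIntegral_le_integral_Icc (fun s => sq_nonneg (k s)) hk.integrable_sq
      le_rfl ht.1 ht.2
    have h2 : 0 ≤ J t := intervalIntegral.integral_nonneg ht.1 fun s _ => sq_nonneg _
    have h3 : (∫ s in (0 : ℝ)..t, k s * φ s) ^ 2 ≤ R * J t :=
      hcs.trans (mul_le_mul_of_nonneg_right (h1.trans hkR) h2)
    have h4 : φ t ^ 2 ≤ (A + ∫ s in (0 : ℝ)..t, k s * φ s) ^ 2 := by
      gcongr
      · exact h0 t ht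
      · exact h t ht
    nlinarith [sq_nonneg (A - ∫ s in (0 : ℝ)..t, k s * φ s)]
  intro t ht
  have hJb : J t ≤ gronwallBound 0 (2 * R) (2 * A ^ 2) (t - 0) := by
    refine le_gronwallBound_of_liminf_deriv_right_le (b := T) (f' := fun t => φ t ^ 2)
      (fun s _ => (hJd s).continuousAt.continuousWithinAt) (fun s _ r hr => ?_)
      (intervalIntegral.integral_same).le (fun s hs => hb s (Ico_subset_Icc_self hs)) t ht
    have h5 := (hasDerivWithinAt_iff_tendsto_slope' (self_notMem_Ioi)).1
      ((hJd s).hasDerivWithinAt (s := Ioi s))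
    refine (h5.eventually_lt_const hr).frequently.mono fun z hz => ?_
    rwa [slope_def_module, smul_eq_mul] at hz
  rw [gronwallBound_of_K_ne_0 (by positivity)] at hJb
  simp only [zero_mul, zero_add, sub_zero] at hJb
  have h6 := hb t ht
  have h7 : Real.exp (2 * R * t) ≤ Real.exp (2 * R * T) := by
    gcongr
    exact ht.2
  calc φ t ^ 2 ≤ 2 * R * (2 * A ^ 2 / (2 * R) * (Real.exp (2 * R * t) - 1)) + 2 * A ^ 2 := by
        refine h6.trans ?_
        gcongr
    _ = 2 * A ^ 2 * Real.exp (2 * R * t) := by field_simp; ring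
    _ ≤ _ := by gcongr

/-! ### Vanishing integrals by local freezing, and equicontinuity -/

/-- Cut the interval into finitely many pieces of length at most `δ`. On each piece the approximants
have vanishing integrals, and the errors add up to at most `ε ∫ v ≤ ε C` however many pieces there
are. The approximants may depend on the piece, which is what allows a factor to be frozen there. -/
theorem tendsto_integral_of_local_approx {T C : ℝ} {F v : ℕ → ℝ → ℝ}
    (hF : ∀ n, Integrable (F n) (volume.restrict (Icc 0 T)))
    (hv : ∀ n, Integrable (v n) (volume.restrict (Icc 0 T))) (hv0 : ∀ n s, 0 ≤ v n s)
    (hC : ∀ n, ∫ s in Icc 0 T, v n s ≤ C)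
    (H : ∀ ε > 0, ∃ δ > 0, ∀ a b, 0 ≤ a → a ≤ b → b ≤ T → b - a ≤ δ → ∃ G : ℕ → ℝ → ℝ,
      (∀ n, IntervalIntegrable (G n) volume a b) ∧
      Tendsto (fun n => ∫ s in a..b, G n s) atTop (𝓝 0) ∧
      ∀ n, ∀ᵐ s, s ∈ Ioc a b → |F n s - G n s| ≤ ε * v n s)
    {a b : ℝ} (ha : 0 ≤ a) (hab : a ≤ b) (hb : b ≤ T) :
    Tendsto (fun n => ∫ s in a..b, F n s) atTop (𝓝 0) := by
  have key : ∀ ε > 0, ∃ R : ℕ → ℝ, Tendsto R atTop (𝓝 0) ∧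
      ∀ n, |∫ s in a..b, F n s| ≤ R n + ε * ∫ s in a..b, v n s := by
    intro ε hε
    obtain ⟨δ, hδ, H⟩ := H ε hε
    have ind : ∀ m : ℕ, ∀ a b, 0 ≤ a → a ≤ b → b ≤ T → b - a ≤ m * δ →
        ∃ R : ℕ → ℝ, Tendsto R atTop (𝓝 0) ∧
        ∀ n, |∫ s in a..b, F n s| ≤ R n + ε * ∫ s in a..b, v n s := by
      intro m
      induction m with
      | zero =>
        intro a b ha hab hb hm
        have : b = a := by simp at hm; linarith
        subst this
        exact ⟨fun _ => 0, tendsto_const_nhds, fun n => by simp⟩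
      | succ m ih =>
        intro a b ha hab hb hm
        push_cast at hm
        -- The last piece `[c, b]` has length at most `δ`; the maximum covers intervals shorter than
        -- `δ`.
        set c := max a (b - δ) with hc
        have hac : a ≤ c := le_max_left _ _
        have hcb : c ≤ b := max_le hab (by linarith)
        obtain ⟨R, hR, hR'⟩ := ih a c ha hac (hcb.trans hb) (by
          have : c ≤ a + m * δ := max_le (by nlinarith [(Nat.cast_nonneg m : (0 : ℝ) ≤ m)])
            (by linarith)
          linarith)
        obtain ⟨G, hG, hG0, hGv⟩ := H c b (ha.trans hac) hcb hb (by linarith [le_max_right a (b - δ)])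
        have ma : a ∈ Icc 0 T := ⟨ha, hab.trans hb⟩
        have mb : b ∈ Icc 0 T := ⟨ha.trans hab, hb⟩
        have mc : c ∈ Icc 0 T := ⟨ha.trans hac, hcb.trans hb⟩
        refine ⟨fun n => R n + |∫ s in c..b, G n s|, by simpa using hR.add hG0.abs, fun n => ?_⟩
        have hFcb := (hF n).intervalIntegrable_of_mem mc mb
        have hvcb := (hv n).intervalIntegrable_of_mem mc mb
        rw [← intervalIntegral.integral_add_adjacent_intervals
          ((hF n).intervalIntegrable_of_mem ma mc) hFcb,
          ← intervalIntegral.integral_add_adjacent_intervals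
          ((hv n).intervalIntegrable_of_mem ma mc) hvcb]
        have h1 : |∫ s in c..b, (F n s - G n s)| ≤ ε * ∫ s in c..b, v n s := by
          rw [← intervalIntegral.integral_const_mul, ← Real.norm_eq_abs]
          exact intervalIntegral.norm_integral_le_of_norm_le hcb (hGv n) (hvcb.const_mul ε)
        rw [intervalIntegral.integral_sub hFcb (hG n)] at h1
        have h2 := hR' n
        rw [abs_le] at h1 h2 ⊢
        have h3 := neg_abs_le (∫ s in c..b, G n s)
        have h4 := le_abs_self (∫ s in c..b, G n s)
        constructor <;> linarith [h1.1, h1.2, h2.1, h2.2]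
    obtain ⟨m, hm⟩ := exists_nat_ge ((b - a) / δ)
    exact ind m a b ha hab hb ((div_le_iff₀ hδ).1 hm)
  rw [Metric.tendsto_atTop]
  intro η hη
  have hC1 : 0 < |C| + 1 := by positivity
  obtain ⟨R, hR, hR'⟩ := key (η / 2 / (|C| + 1)) (by positivity)
  obtain ⟨n₀, hn₀⟩ := Metric.tendsto_atTop.1 hR (η / 2) (by positivity)
  refine ⟨n₀, fun n hn => ?_⟩
  have h1 := hn₀ n hn
  rw [Real.dist_eq, sub_zero] at h1 ⊢
  have h2 : ∫ s in a..b, v n s ≤ |C| + 1 :=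
    (intervalIntegral_le_integral_Icc (hv0 n) (hv n) ha hab hb).trans
      ((hC n).trans (by linarith [le_abs_self C]))
  have h3 : η / 2 / (|C| + 1) * ∫ s in a..b, v n s ≤ η / 2 := by
    calc _ ≤ η / 2 / (|C| + 1) * (|C| + 1) := by gcongr
      _ = η / 2 := by field_simp
  linarith [hR' n, le_abs_self (R n)]

/-- Pointwise convergence on a finite `δ`-net of the compact interval becomes uniform through the
common modulus of continuity. -/
theorem eventually_forall_abs_le_of_holder {T C : ℝ} {r : ℕ → ℝ → ℝ}
    (hr : ∀ t ∈ Icc 0 T, Tendsto (fun n => r n t) atTop (𝓝 0))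
    (hC : ∀ n, ∀ s ∈ Icc 0 T, ∀ t ∈ Icc 0 T, |r n s - r n t| ≤ C * √|s - t|)
    {ε : ℝ} (hε : 0 < ε) : ∀ᶠ n in atTop, ∀ t ∈ Icc 0 T, |r n t| ≤ ε := by
  obtain ⟨δ, hδ, hδC⟩ : ∃ δ > 0, ∀ z : ℝ, |z| < δ → C * √|z| < ε / 2 := by
    have h1 : Tendsto (fun z : ℝ => C * √|z|) (𝓝 0) (𝓝 0) := by
      have : Continuous fun z : ℝ => C * √|z| := by fun_prop
      simpa using this.tendsto 0
    obtain ⟨δ, hδ, h⟩ := Metric.eventually_nhds_iff.1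
      (h1.eventually_lt_const (show 0 < ε / 2 by positivity))
    exact ⟨δ, hδ, fun z hz => h (by simpa using hz)⟩
  obtain ⟨S, hS, hSf, hcov⟩ :=
    finite_cover_balls_of_compact (isCompact_Icc (a := (0 : ℝ)) (b := T)) hδ
  have h2 : ∀ᶠ n in atTop, ∀ s ∈ S, |r n s| < ε / 2 := by
    rw [eventually_all_finite hSf]
    intro s hs
    have := (hr s (hS hs)).abs
    rw [abs_zero] at this
    exact this.eventually_lt_const (by positivity)
  filter_upwards [h2] with n hn t ht
  obtain ⟨s, hs, hts⟩ := mem_iUnion₂.1 (hcov ht)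
  have h3 := hC n t ht s (hS hs)
  have h4 := hδC (t - s) (by rwa [← Real.dist_eq])
  have h5 := hn s hs
  have : |r n t| ≤ |r n t - r n s| + |r n s| := by
    simpa using abs_add_le (r n t - r n s) (r n s)
  linarith

/-! ### Energy equality and estimate in the triple -/

section Energy

variable {F U : Type*} [NormedAddCommGroup F] [InnerProductSpace ℝ F] [CompleteSpace F]
  [NormedAddCommGroup U] [InnerProductSpace ℝ U] [CompleteSpace U]

/-- `D` solves `dD = (i* i - 1) ψ dt + g dt`, `D(0) = 0`, in the triple given by `i : F → U`, with
`D = i* d`; the path `Z` is the time integral of `ψ`, and is assumed to take values in `F`. -/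
structure IsTriplePath (i : F →L[ℝ] U) (T : ℝ) (D Z : ℝ → F) (ψ d : ℝ → U) (g : ℝ → F) : Prop where
  cont : Continuous D
  memLp_drift : MemLp ψ 2 (volume.restrict (Icc 0 T))
  memLp_density : MemLp d 2 (volume.restrict (Icc 0 T))
  integrable_force : Integrable g (volume.restrict (Icc 0 T))
  eqn : ∀ t ∈ Icc 0 T,
    D t = ContinuousLinearMap.adjoint i (i (Z t)) - Z t + ∫ s in (0 : ℝ)..t, g s
  map_primitive : ∀ t ∈ Icc 0 T, i (Z t) = ∫ s in (0 : ℝ)..t, ψ s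
  ae_eq : ∀ᵐ s ∂volume.restrict (Icc 0 T), D s = ContinuousLinearMap.adjoint i (d s)

namespace IsTriplePath

variable {i : F →L[ℝ] U} {T : ℝ} {D Z : ℝ → F} {ψ d : ℝ → U} {g : ℝ → F}

theorem integrable_drift (h : IsTriplePath i T D Z ψ d g) :
    Integrable ψ (volume.restrict (Icc 0 T)) :=
  h.memLp_drift.integrable one_le_two

theorem integrable_velocity (h : IsTriplePath i T D Z ψ d g) :
    Integrable (fun s => i (ContinuousLinearMap.adjoint i (ψ s)) - ψ s + i (g s))
      (volume.restrict (Icc 0 T)) :=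
  (((i ∘L ContinuousLinearMap.adjoint i).integrable_comp h.integrable_drift).sub
    h.integrable_drift).add (i.integrable_comp h.integrable_force)

/-- The drift `ψ` is integrable in `U` but need not lie in `F`. Applying `i` replaces `Z` by the
integral of `ψ`, so the path becomes a genuine primitive in `U`. -/
theorem map_eq_integral (h : IsTriplePath i T D Z ψ d g) {t : ℝ} (ht : t ∈ Icc 0 T) :
    i (D t) = ∫ s in (0 : ℝ)..t, (i (ContinuousLinearMap.adjoint i (ψ s)) - ψ s + i (g s)) := by
  have m0 : (0 : ℝ) ∈ Icc 0 T := ⟨le_rfl, ht.1.trans ht.2⟩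
  have h1 := h.integrable_drift.intervalIntegrable_of_mem m0 ht
  have h2 := h.integrable_force.intervalIntegrable_of_mem m0 ht
  have h3 : IntervalIntegrable (fun s => i (ContinuousLinearMap.adjoint i (ψ s))) volume 0 t :=
    ((i ∘L ContinuousLinearMap.adjoint i).integrable_comp
      h.integrable_drift).intervalIntegrable_of_mem m0 ht
  have h4 : IntervalIntegrable (fun s => i (g s)) volume 0 t :=
    (i.integrable_comp h.integrable_force).intervalIntegrable_of_mem m0 ht
  rw [intervalIntegral.integral_add (h3.sub h1) h4, intervalIntegral.integral_sub h3 h1,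
    h.eqn t ht, map_add, map_sub, h.map_primitive t ht, i.intervalIntegral_comp_comm h2]
  congr 2
  exact ((i ∘L ContinuousLinearMap.adjoint i).intervalIntegral_comp_comm h1).symm

/-- The energy equality. -/
theorem norm_sq_eq (h : IsTriplePath i T D Z ψ d g) (hi : Function.Injective i)
    (hd : DenseRange i) {t : ℝ} (ht : t ∈ Icc 0 T) :
    ‖D t‖ ^ 2 = 2 * ∫ s in (0 : ℝ)..t,
      (inner ℝ (i (ContinuousLinearMap.adjoint i (ψ s)) - ψ s) (d s) + inner ℝ (g s) (D s)) := by
  obtain ⟨N, hNs, hNb, hNt, hSb, hSt⟩ := exists_regularization hi hd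
  have hei : ∀ u f, inner ℝ (ContinuousLinearMap.adjoint i u) f = inner ℝ u (i f) := fun u f =>
    ContinuousLinearMap.adjoint_inner_left i f u
  have hie : ∀ u f, inner ℝ f (ContinuousLinearMap.adjoint i u) = inner ℝ (i f) u := fun u f =>
    ContinuousLinearMap.adjoint_inner_right i f u
  set e := ContinuousLinearMap.adjoint i with he
  set ξ : ℝ → U := fun s => i (e (ψ s)) - ψ s + i (g s) with hξ
  have m0 : (0 : ℝ) ∈ Icc 0 T := ⟨le_rfl, ht.1.trans ht.2⟩
  have hmono := restrict_Ioc_le_restrict_Icc (le_refl 0) ht.2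
  -- The chain rule in `U` for the form `⟨N n ·, ·⟩`, which approximates the squared norm of `F`
  -- pulled back along `i`.
  have hq : ∀ n, 2 * ∫ s in (0 : ℝ)..t, inner ℝ (N n (ξ s)) (i (D s))
      = inner ℝ (D t) (e (N n (i (D t)))) := by
    intro n
    rw [hie, ← hNs, h.map_eq_integral ht, ← integral_inner_symmetric_primitive (N n) (hNs n)
      (h.integrable_velocity.intervalIntegrable_of_mem m0 ht)]
    congr 1
    refine intervalIntegral.integral_congr fun s hs => ?_
    rw [uIcc_of_le ht.1] at hs
    rw [h.map_eq_integral ⟨hs.1, hs.2.trans ht.2⟩]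
  have hl : Tendsto (fun n => inner ℝ (D t) (e (N n (i (D t))))) atTop (𝓝 (‖D t‖ ^ 2)) := by
    rw [← real_inner_self_eq_norm_sq]
    exact tendsto_const_nhds.inner (hSt (D t))
  refine tendsto_nhds_unique hl ?_
  simp only [← hq]
  refine Tendsto.const_mul 2 ?_
  have hae : ∀ᵐ s, s ∈ uIoc 0 t → D s = e (d s) := by
    rw [uIoc_of_le ht.1, ← ae_restrict_iff' measurableSet_Ioc]
    exact ae_mono hmono h.ae_eq
  -- `N n` alone is not bounded uniformly in `n`. With `D = e d` it occurs only inside `i e N` and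
  -- `e N i`, which are, and which converge strongly to the identity; dominated convergence then
  -- applies.
  have hsplit : ∀ n s, D s = e (d s) → inner ℝ (N n (ξ s)) (i (D s))
      = inner ℝ (i (e (N n (i (e (ψ s)) - ψ s)))) (d s) + inner ℝ (e (N n (i (g s)))) (D s) := by
    intro n s hs
    rw [hξ, hei (N n (i (g s))), map_add, inner_add_left, ← hie (d s), hei, ← hs]
  have hcm : MemLp (fun s => i (e (ψ s)) - ψ s) 2 (volume.restrict (Icc 0 T)) :=
    ((i ∘L e).comp_memLp' h.memLp_drift).sub h.memLp_drift
  refine intervalIntegral.tendsto_integral_filter_of_dominated_convergence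
    (fun s => 2 * (‖i (e (ψ s)) - ψ s‖ * ‖d s‖) + ‖g s‖ * ‖D s‖)
    (Eventually.of_forall fun n => ?_) (Eventually.of_forall fun n => ?_) ?_ ?_
  · rw [uIoc_of_le ht.1]
    refine AEStronglyMeasurable.inner (𝕜 := ℝ) ?_ ?_
    · exact (N n).continuous.comp_aestronglyMeasurable
        (h.integrable_velocity.aestronglyMeasurable.mono_measure hmono)
    · exact (i.continuous.comp h.cont).aestronglyMeasurable
  · filter_upwards [hae] with s hs hst
    rw [hsplit n s (hs hst)]
    refine (norm_add_le _ _).trans (add_le_add ?_ ?_)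
    · refine (norm_inner_le_norm _ _).trans ?_
      rw [← mul_assoc]
      gcongr
      exact hNb n _
    · refine (norm_inner_le_norm _ _).trans ?_
      gcongr
      exact hSb n _
  · refine Integrable.intervalIntegrable_of_mem (T := T) ?_ m0 ht
    refine ((hcm.norm.integrable_mul h.memLp_density.norm).const_mul 2).add ?_
    exact h.integrable_force.norm.mul_of_top_left (h.cont.norm.memLp_restrict_Icc 0 T ⊤)
  · filter_upwards [hae] with s hs hst
    simp only [fun n => hsplit n s (hs hst)]
    exact ((hNt _).inner tendsto_const_nhds).add ((hSt _).inner tendsto_const_nhds)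

/-- The energy estimate for a monotone drift. -/
theorem norm_sq_add_le (h : IsTriplePath i T D Z ψ d g) (hi : Function.Injective i)
    (hd : DenseRange i) {κ : ℝ} (hκ : 0 < κ)
    (hmon : ∀ᵐ s ∂volume.restrict (Icc 0 T), ‖ψ s‖ ^ 2 ≤ κ * inner ℝ (ψ s) (d s)) {t : ℝ}
    (ht : t ∈ Icc 0 T) :
    ‖D t‖ ^ 2 + κ⁻¹ * ∫ s in (0 : ℝ)..t, ‖ψ s‖ ^ 2
      ≤ ∫ s in (0 : ℝ)..t, (κ * ‖i‖ ^ 2 * ‖D s‖ ^ 2 + 2 * inner ℝ (g s) (D s)) := by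
  have hei : ∀ u f, inner ℝ (ContinuousLinearMap.adjoint i u) f = inner ℝ u (i f) := fun u f =>
    ContinuousLinearMap.adjoint_inner_left i f u
  have hie : ∀ u f, inner ℝ f (ContinuousLinearMap.adjoint i u) = inner ℝ (i f) u := fun u f =>
    ContinuousLinearMap.adjoint_inner_right i f u
  have m0 : (0 : ℝ) ∈ Icc 0 T := ⟨le_rfl, ht.1.trans ht.2⟩
  have hmono := restrict_Ioc_le_restrict_Icc (le_refl 0) ht.2
  have hg : Integrable (fun s => inner ℝ (g s) (D s)) (volume.restrict (Icc 0 T)) := by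
    refine Integrable.mono' (g := fun s => ‖g s‖ * ‖D s‖)
      (h.integrable_force.norm.mul_of_top_left (h.cont.norm.memLp_restrict_Icc 0 T ⊤))
      (h.integrable_force.aestronglyMeasurable.inner h.cont.aestronglyMeasurable)
      (Eventually.of_forall fun s => norm_inner_le_norm _ _)
  have hcm : MemLp (fun s => i (ContinuousLinearMap.adjoint i (ψ s)) - ψ s) 2
      (volume.restrict (Icc 0 T)) :=
    ((i ∘L ContinuousLinearMap.adjoint i).comp_memLp' h.memLp_drift).sub h.memLp_drift
  have hcd : Integrable (fun s => inner ℝ (i (ContinuousLinearMap.adjoint i (ψ s)) - ψ s) (d s))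
      (volume.restrict (Icc 0 T)) := by
    refine Integrable.mono' (hcm.norm.integrable_mul h.memLp_density.norm)
      (hcm.aestronglyMeasurable.inner h.memLp_density.aestronglyMeasurable)
      (Eventually.of_forall fun s => norm_inner_le_norm _ _)
  have hψ2 : Integrable (fun s => κ⁻¹ * ‖ψ s‖ ^ 2) (volume.restrict (Icc 0 T)) :=
    h.memLp_drift.norm.integrable_sq.const_mul _
  have hD2 : Integrable (fun s => κ * ‖i‖ ^ 2 * ‖D s‖ ^ 2) (volume.restrict (Icc 0 T)) :=
    (h.cont.norm.memLp_restrict_Icc 0 T 2).integrable_sq.const_mul _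
  have hI : Integrable (fun s => 2 * (inner ℝ (i (ContinuousLinearMap.adjoint i (ψ s)) - ψ s) (d s)
      + inner ℝ (g s) (D s))) (volume.restrict (Icc 0 T)) := (hcd.add hg).const_mul 2
  rw [h.norm_sq_eq hi hd ht, ← intervalIntegral.integral_const_mul,
    ← intervalIntegral.integral_const_mul, ← intervalIntegral.integral_add
      (hI.intervalIntegrable_of_mem m0 ht) (hψ2.intervalIntegrable_of_mem m0 ht)]
  refine intervalIntegral.integral_mono_ae_restrict ht.1
    ((hI.add hψ2).intervalIntegrable_of_mem m0 ht)
    ((hD2.add (hg.const_mul 2)).intervalIntegrable_of_mem m0 ht) ?_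
  have hle : volume.restrict (Icc 0 t) ≤ (volume.restrict (Icc 0 T) : Measure ℝ) :=
    Measure.restrict_mono (Icc_subset_Icc_right ht.2) le_rfl
  filter_upwards [ae_mono hle h.ae_eq, ae_mono hle hmon] with s hs hm
  have h1 : inner ℝ (i (ContinuousLinearMap.adjoint i (ψ s))) (d s) = inner ℝ (ψ s) (i (D s)) := by
    rw [hs, ← hie, hei]
  have h2 : inner ℝ (ψ s) (i (D s)) ≤ ‖ψ s‖ * (‖i‖ * ‖D s‖) :=
    (real_inner_le_norm _ _).trans (by gcongr; exact i.le_opNorm _)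
  have h3 : κ⁻¹ * ‖ψ s‖ ^ 2 ≤ inner ℝ (ψ s) (d s) := (inv_mul_le_iff₀ hκ).2 hm
  -- Monotonicity supplies `-2 κ⁻¹ ‖ψ‖²`. The weight in Young's inequality spends half of it,
  -- leaving the other half for the left-hand side.
  have h4 : 2 * (‖ψ s‖ * (‖i‖ * ‖D s‖)) ≤ κ⁻¹ * ‖ψ s‖ ^ 2 + κ * ‖i‖ ^ 2 * ‖D s‖ ^ 2 := by
    have h5 : 0 ≤ κ⁻¹ * (‖ψ s‖ - κ * (‖i‖ * ‖D s‖)) ^ 2 := by positivity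
    have h6 : κ⁻¹ * (‖ψ s‖ - κ * (‖i‖ * ‖D s‖)) ^ 2
        = κ⁻¹ * ‖ψ s‖ ^ 2 - 2 * (‖ψ s‖ * (‖i‖ * ‖D s‖)) + κ * ‖i‖ ^ 2 * ‖D s‖ ^ 2 := by
      field_simp
      ring
    linarith
  simp only [inner_sub_left, h1]
  linarith

end IsTriplePath

end Energy

/-! ### Uniform bounds for controlled families -/

theorem integral_Icc_const_mul_le {T R c : ℝ} (hT : 0 ≤ T) {f : ℝ → ℝ} (hc : 0 ≤ c)
    (hf : MemLp f 2 (volume.restrict (Icc 0 T))) (hR : ∫ s in Icc 0 T, f s ^ 2 ≤ R) :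
    ∫ s in Icc 0 T, c * f s ≤ c * ((T + R) / 2) := by
  rw [integral_const_mul]
  refine mul_le_mul_of_nonneg_left ?_ hc
  have h1 : ∫ s in Icc 0 T, f s ≤ ∫ s in Icc 0 T, (1 / 2 + f s ^ 2 / 2) := by
    refine integral_mono (hf.integrable one_le_two)
      ((integrable_const _).add (hf.integrable_sq.div_const 2)) fun s => ?_
    simp only
    nlinarith [sq_nonneg (f s - 1)]
  rw [integral_add (integrable_const _) (hf.integrable_sq.div_const 2), integral_div,
    integral_div] at h1
  have h2 : ∫ _ in Icc 0 T, (1 : ℝ) = T := by simp [hT]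
  rw [h2] at h1
  linarith

/-- Cauchy–Schwarz against the constant 1: a square integrable majorant of the velocity gives Hölder
exponent 1/2. -/
theorem norm_intervalIntegral_le_sqrt {X : Type*} [NormedAddCommGroup X] [NormedSpace ℝ X]
    {T C : ℝ} {ξ : ℝ → X} {w : ℝ → ℝ} (hw : MemLp w 2 (volume.restrict (Icc 0 T)))
    (hC : ∫ s in Icc 0 T, w s ^ 2 ≤ C)
    (hξ : ∀ᵐ s ∂volume.restrict (Icc 0 T), ‖ξ s‖ ≤ w s) {s t : ℝ} (hs : s ∈ Icc 0 T)
    (ht : t ∈ Icc 0 T) : ‖∫ r in s..t, ξ r‖ ≤ √C * √|s - t| := by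
  wlog hst : s ≤ t generalizing s t
  · rw [intervalIntegral.integral_symm, norm_neg, abs_sub_comm]
    exact this ht hs (le_of_not_ge hst)
  have hm := restrict_Ioc_le_restrict_Icc hs.1 ht.2
  have hc1 : MemLp (fun _ : ℝ => (1 : ℝ)) 2 (volume.restrict (Ioc s t)) := memLp_const 1
  have h1 : ‖∫ r in s..t, ξ r‖ ≤ ∫ r in s..t, w r := by
    refine intervalIntegral.norm_integral_le_of_norm_le hst ?_
      ((hw.integrable one_le_two).intervalIntegrable_of_mem hs ht)
    rw [← ae_restrict_iff' measurableSet_Ioc]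
    exact ae_mono hm hξ
  have h2 := sq_integral_mul_le (hw.mono_measure hm) hc1
  simp only [mul_one, one_pow] at h2
  have h3 : ∫ _ in Ioc s t, (1 : ℝ) = t - s := by simp [hst]
  have h4 : ∫ r in Ioc s t, w r ^ 2 ≤ C :=
    (integral_mono_measure hm (Eventually.of_forall fun r => sq_nonneg _) hw.integrable_sq).trans hC
  rw [h3, ← intervalIntegral.integral_of_le hst] at h2
  have hC0 : 0 ≤ C := (integral_nonneg fun r => sq_nonneg _).trans hC
  rw [abs_sub_comm, abs_of_nonneg (sub_nonneg.2 hst), ← Real.sqrt_mul hC0]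
  refine h1.trans (Real.le_sqrt_of_sq_le (h2.trans ?_))
  exact mul_le_mul_of_nonneg_right h4 (sub_nonneg.2 hst)

section Family

variable {F U : Type*} [NormedAddCommGroup F] [InnerProductSpace ℝ F] [CompleteSpace F]
  [NormedAddCommGroup U] [InnerProductSpace ℝ U] [CompleteSpace U]

/-- The span of the rank one operators `u ↦ ⟨f, u⟩ i* w`. -/
def regularRankOneSpan (i : F →L[ℝ] U) : Submodule ℝ (U →L[ℝ] F) :=
  Submodule.span ℝ (range fun p : U × U =>
    (innerSL ℝ p.1).smulRight (ContinuousLinearMap.adjoint i p.2))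

/-- A sequence of triple paths with monotone drifts, and forces that are `β k n` up to a term that is
Lipschitz in the path. -/
structure IsControlledFamily (i : F →L[ℝ] U) (T κ R C₁ b : ℝ) (D Z : ℕ → ℝ → F) (ψ d : ℕ → ℝ → U)
    (g : ℕ → ℝ → F) (β : ℝ → U →L[ℝ] F) (k : ℕ → ℝ → U) (η : ℕ → ℝ → ℝ) : Prop where
  inj : Function.Injective i
  dense : DenseRange i
  T_pos : 0 < T
  κ_pos : 0 < κ
  C₁_nonneg : 0 ≤ C₁
  b_nonneg : 0 ≤ b
  path : ∀ n, IsTriplePath i T (D n) (Z n) (ψ n) (d n) (g n)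
  mono : ∀ n, ∀ᵐ s ∂volume.restrict (Icc 0 T), ‖ψ n s‖ ^ 2 ≤ κ * inner ℝ (ψ n s) (d n s)
  memLp_k : ∀ n, MemLp (k n) 2 (volume.restrict (Icc 0 T))
  k_le : ∀ n, ∫ s in Icc 0 T, ‖k n s‖ ^ 2 ≤ R
  memLp_η : ∀ n, MemLp (η n) 2 (volume.restrict (Icc 0 T))
  η_nonneg : ∀ n s, 0 ≤ η n s
  η_le : ∀ n, ∫ s in Icc 0 T, η n s ^ 2 ≤ R
  meas_β : AEStronglyMeasurable β (volume.restrict (Icc 0 T))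
  β_le : ∀ᵐ s ∂volume.restrict (Icc 0 T), ‖β s‖ ≤ b
  force : ∀ n, ∀ᵐ s ∂volume.restrict (Icc 0 T),
    ‖g n s - β s (k n s)‖ ≤ C₁ * ‖D n s‖ * η n s

namespace IsControlledFamily

variable {i : F →L[ℝ] U} {T κ R C₁ b : ℝ} {D Z : ℕ → ℝ → F} {ψ d : ℕ → ℝ → U}
    {g : ℕ → ℝ → F} {β : ℝ → U →L[ℝ] F} {k : ℕ → ℝ → U} {η : ℕ → ℝ → ℝ}

/-- In the energy estimate the force contributes at most `2 C₁ η ‖D‖² + b ‖k‖ (1 + ‖D‖²)`. All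
coefficients are bounded in `L²`, so Grönwall's inequality controls `D`; the retained term in `ψ` is
then controlled at time `T`. -/
theorem exists_bound (h : IsControlledFamily i T κ R C₁ b D Z ψ d g β k η) :
    ∃ C, 0 ≤ C ∧ (∀ n, ∀ t ∈ Icc 0 T, ‖D n t‖ ≤ C) ∧
      ∀ n, ∫ s in Icc 0 T, ‖ψ n s‖ ^ 2 ≤ C := by
  have hT := h.T_pos
  have hκ := h.κ_pos
  have hC₁ := h.C₁_nonneg
  have hb := h.b_nonneg
  have hR : 0 ≤ R := (integral_nonneg fun s => sq_nonneg _).trans (h.η_le 0)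
  set c : ℝ := κ * ‖i‖ ^ 2 with hc
  set q : ℕ → ℝ → ℝ := fun n s => c + 2 * C₁ * η n s + b * ‖k n s‖ with hq
  have hqL : ∀ n, MemLp (q n) 2 (volume.restrict (Icc 0 T)) := fun n =>
    ((memLp_const c).add ((h.memLp_η n).const_mul _)).add ((h.memLp_k n).norm.const_mul b)
  -- The factor 3 comes from squaring a sum of three terms; the summand 1 ensures that `R₁` is
  -- positive.
  set R₁ : ℝ := 3 * (c ^ 2 * T + (2 * C₁) ^ 2 * R + b ^ 2 * R) + 1 with hR₁
  have hR₁0 : 0 < R₁ := by positivity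
  have hqR : ∀ n, ∫ s in Icc 0 T, q n s ^ 2 ≤ R₁ := by
    intro n
    have i1 : Integrable (fun _ : ℝ => c ^ 2) (volume.restrict (Icc 0 T)) := integrable_const _
    have i2 : Integrable (fun s => (2 * C₁) ^ 2 * η n s ^ 2) (volume.restrict (Icc 0 T)) :=
      (h.memLp_η n).integrable_sq.const_mul _
    have i3 : Integrable (fun s => b ^ 2 * ‖k n s‖ ^ 2) (volume.restrict (Icc 0 T)) :=
      (h.memLp_k n).norm.integrable_sq.const_mul _
    have i12 : Integrable (fun s => c ^ 2 + (2 * C₁) ^ 2 * η n s ^ 2)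
      (volume.restrict (Icc 0 T)) := i1.add i2
    calc ∫ s in Icc 0 T, q n s ^ 2
        ≤ ∫ s in Icc 0 T, 3 * (c ^ 2 + (2 * C₁) ^ 2 * η n s ^ 2 + b ^ 2 * ‖k n s‖ ^ 2) := by
          refine integral_mono (hqL n).integrable_sq ((i12.add i3).const_mul 3) fun s => ?_
          simp only [hq]
          nlinarith [sq_nonneg (c - 2 * C₁ * η n s), sq_nonneg (c - b * ‖k n s‖),
            sq_nonneg (2 * C₁ * η n s - b * ‖k n s‖)]
      _ = 3 * (c ^ 2 * T + (2 * C₁) ^ 2 * (∫ s in Icc 0 T, η n s ^ 2)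
            + b ^ 2 * ∫ s in Icc 0 T, ‖k n s‖ ^ 2) := by
          rw [integral_const_mul, integral_add i12 i3, integral_add i1 i2, integral_const_mul,
            integral_const_mul]
          simp [hT.le, mul_comm]
      _ ≤ R₁ := by
          have h1 := h.η_le n
          have h2 := h.k_le n
          have : 3 * (c ^ 2 * T + (2 * C₁) ^ 2 * (∫ s in Icc 0 T, η n s ^ 2)
            + b ^ 2 * ∫ s in Icc 0 T, ‖k n s‖ ^ 2)
              ≤ 3 * (c ^ 2 * T + (2 * C₁) ^ 2 * R + b ^ 2 * R) := by gcongr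
          linarith
  set A : ℝ := b * ((T + R) / 2) with hA
  have hA0 : 0 ≤ A := by positivity
  have hD2 : ∀ n, Continuous fun s => ‖D n s‖ ^ 2 := fun n => (h.path n).cont.norm.pow 2
  have hqD : ∀ n, Integrable (fun s => q n s * ‖D n s‖ ^ 2) (volume.restrict (Icc 0 T)) := fun n =>
    (hqL n).integrable_mul ((hD2 n).memLp_restrict_Icc 0 T 2)
  have hkI : ∀ n, Integrable (fun s => b * ‖k n s‖) (volume.restrict (Icc 0 T)) := fun n =>
    ((h.memLp_k n).norm.integrable one_le_two).const_mul b
  have key : ∀ n, ∀ t ∈ Icc 0 T, ‖D n t‖ ^ 2 + κ⁻¹ * ∫ s in (0 : ℝ)..t, ‖ψ n s‖ ^ 2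
      ≤ A + ∫ s in (0 : ℝ)..t, q n s * ‖D n s‖ ^ 2 := by
    intro n t ht
    have m0 : (0 : ℝ) ∈ Icc 0 T := ⟨le_rfl, hT.le⟩
    have h1 := (h.path n).norm_sq_add_le h.inj h.dense hκ (h.mono n) ht
    have hg : Integrable (fun s => inner ℝ (g n s) (D n s)) (volume.restrict (Icc 0 T)) := by
      refine Integrable.mono' (g := fun s => ‖g n s‖ * ‖D n s‖)
        ((h.path n).integrable_force.norm.mul_of_top_left
          ((h.path n).cont.norm.memLp_restrict_Icc 0 T ⊤))
        ((h.path n).integrable_force.aestronglyMeasurable.inner (h.path n).cont.aestronglyMeasurable)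
        (Eventually.of_forall fun s => norm_inner_le_norm _ _)
    have h2 : ∫ s in (0 : ℝ)..t, (c * ‖D n s‖ ^ 2 + 2 * inner ℝ (g n s) (D n s))
        ≤ ∫ s in (0 : ℝ)..t, (b * ‖k n s‖ + q n s * ‖D n s‖ ^ 2) := by
      refine intervalIntegral.integral_mono_ae_restrict ht.1
        (((((hD2 n).memLp_restrict_Icc 0 T 1).integrable le_rfl).const_mul c).add
          (hg.const_mul 2) |>.intervalIntegrable_of_mem m0 ht)
        (((hkI n).add (hqD n)).intervalIntegrable_of_mem m0 ht) ?_
      have hle : volume.restrict (Icc 0 t) ≤ (volume.restrict (Icc 0 T) : Measure ℝ) :=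
        Measure.restrict_mono (Icc_subset_Icc_right ht.2) le_rfl
      filter_upwards [ae_mono hle (h.force n), ae_mono hle h.β_le] with s hs hβ
      have h3 : inner ℝ (g n s) (D n s) = inner ℝ (g n s - β s (k n s)) (D n s)
          + inner ℝ (β s (k n s)) (D n s) := by rw [← inner_add_left]; simp
      have h4 : inner ℝ (g n s - β s (k n s)) (D n s) ≤ C₁ * ‖D n s‖ * η n s * ‖D n s‖ :=
        (real_inner_le_norm _ _).trans (by gcongr)
      have h5 : inner ℝ (β s (k n s)) (D n s) ≤ b * ‖k n s‖ * ‖D n s‖ :=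
        (real_inner_le_norm _ _).trans (by gcongr; exact (β s).le_of_opNorm_le hβ _)
      have h6 : b * ‖k n s‖ * (2 * ‖D n s‖) ≤ b * ‖k n s‖ * (1 + ‖D n s‖ ^ 2) := by
        gcongr
        nlinarith [sq_nonneg (‖D n s‖ - 1)]
      simp only [hq]
      nlinarith
    rw [intervalIntegral.integral_add ((hkI n).intervalIntegrable_of_mem m0 ht)
      ((hqD n).intervalIntegrable_of_mem m0 ht)] at h2
    have h3 : ∫ s in (0 : ℝ)..t, b * ‖k n s‖ ≤ A :=
      (intervalIntegral_le_integral_Icc (fun s => by positivity) (hkI n) le_rfl ht.1 ht.2).trans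
        (integral_Icc_const_mul_le hT.le hb (h.memLp_k n).norm (h.k_le n))
    linarith
  -- Grönwall's inequality is applied to `‖D‖²` and bounds its square, hence the root here and a
  -- second one in the bound for `‖D‖`.
  set Φ : ℝ := √(2 * A ^ 2 * Real.exp (2 * R₁ * T)) with hΦ
  have hΦ0 : 0 ≤ Φ := Real.sqrt_nonneg _
  have hDΦ : ∀ n, ∀ t ∈ Icc 0 T, ‖D n t‖ ^ 2 ≤ Φ := by
    intro n t ht
    refine Real.le_sqrt_of_sq_le ?_
    refine sq_le_of_le_add_integral_mul (hD2 n) (hqL n) hR₁0 (hqR n)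
      (fun t _ => sq_nonneg _) (fun t ht => le_trans ?_ (key n t ht)) t ht
    have : 0 ≤ ∫ s in (0 : ℝ)..t, ‖ψ n s‖ ^ 2 :=
      intervalIntegral.integral_nonneg ht.1 fun s _ => sq_nonneg _
    have := mul_nonneg (inv_pos.2 hκ).le this
    linarith
  refine ⟨max (√Φ) (κ * (A + (R₁ + Φ ^ 2 * T) / 2)), le_max_of_le_left (Real.sqrt_nonneg _),
    fun n t ht => le_max_of_le_left (Real.le_sqrt_of_sq_le (hDΦ n t ht)),
    fun n => le_max_of_le_right ?_⟩
  have mT : T ∈ Icc 0 T := ⟨hT.le, le_rfl⟩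
  have h1 := key n T mT
  have h2 : ∫ s in Icc 0 T, q n s * ‖D n s‖ ^ 2 ≤ (R₁ + Φ ^ 2 * T) / 2 := by
    calc ∫ s in Icc 0 T, q n s * ‖D n s‖ ^ 2
        ≤ ∫ s in Icc 0 T, (q n s ^ 2 / 2 + Φ ^ 2 / 2) := by
          refine setIntegral_mono_on (hqD n) (((hqL n).integrable_sq.div_const 2).add
            (integrable_const _)) measurableSet_Icc fun s hs => ?_
          have h3 := hDΦ n s hs
          have h4 : (‖D n s‖ ^ 2) ^ 2 ≤ Φ ^ 2 := by gcongr
          nlinarith [sq_nonneg (q n s - ‖D n s‖ ^ 2)]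
      _ = (∫ s in Icc 0 T, q n s ^ 2) / 2 + T * (Φ ^ 2 / 2) := by
          rw [integral_add ((hqL n).integrable_sq.div_const 2) (integrable_const _), integral_div]
          simp [hT.le]
      _ ≤ _ := by linarith [hqR n]
  rw [intervalIntegral.integral_of_le hT.le, intervalIntegral.integral_of_le hT.le,
    ← integral_Icc_eq_integral_Ioc, ← integral_Icc_eq_integral_Ioc] at h1
  rw [← inv_mul_le_iff₀ hκ]
  linarith [sq_nonneg ‖D n T‖]

/-- Testing the paths against `i* u` gives uniformly Hölder continuous functions. -/
theorem exists_holder (h : IsControlledFamily i T κ R C₁ b D Z ψ d g β k η) :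
    ∃ C, 0 ≤ C ∧ ∀ n u, ∀ s ∈ Icc 0 T, ∀ t ∈ Icc 0 T,
      |inner ℝ (ContinuousLinearMap.adjoint i u) (D n s)
        - inner ℝ (ContinuousLinearMap.adjoint i u) (D n t)| ≤ ‖u‖ * (C * √|s - t|) := by
  obtain ⟨C, hC0, hCD, hCψ⟩ := h.exists_bound
  have hT := h.T_pos
  have hC₁ := h.C₁_nonneg
  have hb := h.b_nonneg
  set e := ContinuousLinearMap.adjoint i with he
  set p : ℝ := ‖i‖ * ‖e‖ + 1 with hp
  have hp0 : 0 ≤ p := by positivity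
  -- A majorant of the velocity of `i D`, bounded in `L²` uniformly in `n`. Testing against `i* u`
  -- sees `D` only through `i D`, so regularity in `U` suffices.
  set w : ℕ → ℝ → ℝ := fun n s => p * ‖ψ n s‖ + ‖i‖ * (C₁ * C) * η n s + ‖i‖ * b * ‖k n s‖ with hw
  have hwL : ∀ n, MemLp (w n) 2 (volume.restrict (Icc 0 T)) := fun n =>
    (((h.path n).memLp_drift.norm.const_mul _).add ((h.memLp_η n).const_mul _)).add
      ((h.memLp_k n).norm.const_mul _)
  set R₂ : ℝ := 3 * (p ^ 2 * C + (‖i‖ * (C₁ * C)) ^ 2 * R + (‖i‖ * b) ^ 2 * R) with hR₂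
  have hwR : ∀ n, ∫ s in Icc 0 T, w n s ^ 2 ≤ R₂ := by
    intro n
    have i1 : Integrable (fun s => p ^ 2 * ‖ψ n s‖ ^ 2) (volume.restrict (Icc 0 T)) :=
      (h.path n).memLp_drift.norm.integrable_sq.const_mul _
    have i2 : Integrable (fun s => (‖i‖ * (C₁ * C)) ^ 2 * η n s ^ 2)
      (volume.restrict (Icc 0 T)) := (h.memLp_η n).integrable_sq.const_mul _
    have i3 : Integrable (fun s => (‖i‖ * b) ^ 2 * ‖k n s‖ ^ 2) (volume.restrict (Icc 0 T)) :=
      (h.memLp_k n).norm.integrable_sq.const_mul _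
    have i12 : Integrable (fun s => p ^ 2 * ‖ψ n s‖ ^ 2 + (‖i‖ * (C₁ * C)) ^ 2 * η n s ^ 2)
      (volume.restrict (Icc 0 T)) := i1.add i2
    calc ∫ s in Icc 0 T, w n s ^ 2
        ≤ ∫ s in Icc 0 T, 3 * (p ^ 2 * ‖ψ n s‖ ^ 2 + (‖i‖ * (C₁ * C)) ^ 2 * η n s ^ 2
            + (‖i‖ * b) ^ 2 * ‖k n s‖ ^ 2) := by
          refine integral_mono (hwL n).integrable_sq ((i12.add i3).const_mul 3) fun s => ?_
          simp only [hw]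
          nlinarith [sq_nonneg (p * ‖ψ n s‖ - ‖i‖ * (C₁ * C) * η n s),
            sq_nonneg (p * ‖ψ n s‖ - ‖i‖ * b * ‖k n s‖),
            sq_nonneg (‖i‖ * (C₁ * C) * η n s - ‖i‖ * b * ‖k n s‖)]
      _ = 3 * (p ^ 2 * (∫ s in Icc 0 T, ‖ψ n s‖ ^ 2)
            + (‖i‖ * (C₁ * C)) ^ 2 * (∫ s in Icc 0 T, η n s ^ 2)
            + (‖i‖ * b) ^ 2 * ∫ s in Icc 0 T, ‖k n s‖ ^ 2) := by
          rw [integral_const_mul, integral_add i12 i3, integral_add i1 i2, integral_const_mul,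
            integral_const_mul, integral_const_mul]
      _ ≤ R₂ := by
          have h1 := h.η_le n
          have h2 := h.k_le n
          have h3 := hCψ n
          rw [hR₂]
          gcongr
  refine ⟨√R₂, Real.sqrt_nonneg _, fun n u s hs t ht => ?_⟩
  have hei : ∀ f, inner ℝ (e u) f = inner ℝ u (i f) := fun f =>
    ContinuousLinearMap.adjoint_inner_left i f u
  have m0 : (0 : ℝ) ∈ Icc 0 T := ⟨le_rfl, hT.le⟩
  rw [hei, hei, ← inner_sub_right, (h.path n).map_eq_integral hs, (h.path n).map_eq_integral ht,
    intervalIntegral.integral_interval_sub_left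
      ((h.path n).integrable_velocity.intervalIntegrable_of_mem m0 hs)
      ((h.path n).integrable_velocity.intervalIntegrable_of_mem m0 ht)]
  refine (abs_real_inner_le_norm _ _).trans (mul_le_mul_of_nonneg_left ?_ (norm_nonneg u))
  rw [abs_sub_comm]
  refine norm_intervalIntegral_le_sqrt (hwL n) (hwR n) ?_ ht hs
  filter_upwards [h.force n, h.β_le, ae_restrict_mem measurableSet_Icc] with r hr hβ hrm
  have h1 : ‖g n r‖ ≤ C₁ * C * η n r + b * ‖k n r‖ := by
    have h2 : ‖g n r‖ ≤ ‖g n r - β r (k n r)‖ + ‖β r (k n r)‖ := by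
      simpa using norm_add_le (g n r - β r (k n r)) (β r (k n r))
    have h3 : C₁ * ‖D n r‖ * η n r ≤ C₁ * C * η n r := by
      gcongr
      · exact h.η_nonneg n r
      · exact hCD n r hrm
    have h4 := (β r).le_of_opNorm_le hβ (k n r)
    linarith
  have h5 : ‖i (e (ψ n r))‖ ≤ ‖i‖ * (‖e‖ * ‖ψ n r‖) :=
    (i.le_opNorm _).trans (by gcongr; exact e.le_opNorm _)
  have h6 : ‖i (g n r)‖ ≤ ‖i‖ * (C₁ * C * η n r + b * ‖k n r‖) :=
    (i.le_opNorm _).trans (by gcongr)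
  have h7 := norm_add_le (i (e (ψ n r)) - ψ n r) (i (g n r))
  have h8 := norm_sub_le (i (e (ψ n r))) (ψ n r)
  simp only [hw, hp]
  linarith

end IsControlledFamily

end Family

/-! ### Convergence of controlled families with weakly null controls -/

section Convergence

variable {F U : Type*} [NormedAddCommGroup F] [InnerProductSpace ℝ F] [CompleteSpace F]
  [NormedAddCommGroup U] [InnerProductSpace ℝ U] [CompleteSpace U]

namespace IsControlledFamily

variable {i : F →L[ℝ] U} {T κ R C₁ b : ℝ} {D Z : ℕ → ℝ → F} {ψ d : ℕ → ℝ → U}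
    {g : ℕ → ℝ → F} {β : ℝ → U →L[ℝ] F} {k : ℕ → ℝ → U} {η : ℕ → ℝ → ℝ}

theorem memLp_inner_apply (h : IsControlledFamily i T κ R C₁ b D Z ψ d g β k η) (A : U →L[ℝ] F)
    (n : ℕ) : MemLp (fun s => inner ℝ (A (k n s)) (D n s)) 2 (volume.restrict (Icc 0 T)) := by
  obtain ⟨C, hC0, hC, -⟩ := h.exists_bound
  refine MemLp.of_le_mul (g := k n) (c := ‖A‖ * C) (h.memLp_k n)
    ((A.continuous.comp_aestronglyMeasurable (h.memLp_k n).aestronglyMeasurable).inner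
      (h.path n).cont.aestronglyMeasurable) ?_
  filter_upwards [ae_restrict_mem measurableSet_Icc] with s hs
  calc _ ≤ ‖A (k n s)‖ * ‖D n s‖ := norm_inner_le_norm _ _
    _ ≤ (‖A‖ * ‖k n s‖) * C := by
      gcongr
      · exact A.le_opNorm _
      · exact hC n s hs
    _ = _ := by ring

theorem intervalIntegrable_inner_apply (h : IsControlledFamily i T κ R C₁ b D Z ψ d g β k η)
    (A : U →L[ℝ] F) (n : ℕ) {s t : ℝ} (hs : s ∈ Icc 0 T) (ht : t ∈ Icc 0 T) :
    IntervalIntegrable (fun s => inner ℝ (A (k n s)) (D n s)) volume s t :=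
  ((h.memLp_inner_apply A n).integrable one_le_two).intervalIntegrable_of_mem hs ht

theorem integrable_inner_coeff (h : IsControlledFamily i T κ R C₁ b D Z ψ d g β k η) (n : ℕ) :
    Integrable (fun s => inner ℝ (β s (k n s)) (D n s)) (volume.restrict (Icc 0 T)) := by
  obtain ⟨C, hC0, hC, -⟩ := h.exists_bound
  have hm : AEStronglyMeasurable (fun s => β s (k n s)) (volume.restrict (Icc 0 T)) :=
    isBoundedBilinearMap_apply.continuous.comp_aestronglyMeasurable
      (h.meas_β.prodMk (h.memLp_k n).aestronglyMeasurable)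
  refine Integrable.mono' (g := fun s => b * C * ‖k n s‖)
    (((h.memLp_k n).norm.integrable one_le_two).const_mul _)
    (hm.inner (h.path n).cont.aestronglyMeasurable) ?_
  filter_upwards [ae_restrict_mem measurableSet_Icc, h.β_le] with s hs hβ
  calc _ ≤ ‖β s (k n s)‖ * ‖D n s‖ := norm_inner_le_norm _ _
    _ ≤ (b * ‖k n s‖) * C := by
      gcongr
      · exact mul_nonneg h.b_nonneg (norm_nonneg _)
      · exact (β s).le_of_opNorm_le hβ _
      · exact hC n s hs
    _ = _ := by ring

/-- On a short interval `⟨i* u, D n⟩` is nearly its value at the left endpoint, uniformly in `n`.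
Once frozen it is a bounded factor, multiplying an integral of `⟨f, k n⟩` that tends to zero. -/
theorem tendsto_integral_rankOne (h : IsControlledFamily i T κ R C₁ b D Z ψ d g β k η)
    (hk : ∀ f : U, ∀ s ∈ Icc 0 T, ∀ t ∈ Icc 0 T,
      Tendsto (fun n => ∫ r in s..t, inner ℝ f (k n r)) atTop (𝓝 0)) (f u : U) {s t : ℝ}
    (hs : 0 ≤ s) (hst : s ≤ t) (ht : t ≤ T) :
    Tendsto (fun n => ∫ r in s..t,
      inner ℝ f (k n r) * inner ℝ (ContinuousLinearMap.adjoint i u) (D n r)) atTop (𝓝 0) := by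
  obtain ⟨C, hC0, hC, -⟩ := h.exists_bound
  obtain ⟨C', hC0', hC'⟩ := h.exists_holder
  have hb : ∀ n, ∀ r ∈ Icc 0 T, |inner ℝ (ContinuousLinearMap.adjoint i u) (D n r)|
      ≤ ‖ContinuousLinearMap.adjoint i u‖ * C := fun n r hr =>
    (abs_real_inner_le_norm _ _).trans (by gcongr; exact hC n r hr)
  have hfk : ∀ n, MemLp (fun r => inner ℝ f (k n r)) 2 (volume.restrict (Icc 0 T)) := fun n =>
    (innerSL ℝ f).comp_memLp' (h.memLp_k n)
  have hc : ∀ n, Continuous fun r => inner ℝ (ContinuousLinearMap.adjoint i u) (D n r) := fun n =>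
    continuous_const.inner (h.path n).cont
  have hkI : ∀ n, Integrable (fun r => ‖f‖ * ‖k n r‖) (volume.restrict (Icc 0 T)) := fun n =>
    ((h.memLp_k n).norm.integrable one_le_two).const_mul _
  refine tendsto_integral_of_local_approx (v := fun n r => ‖f‖ * ‖k n r‖)
    (fun n => (hfk n).integrable_mul ((hc n).memLp_restrict_Icc 0 T 2)) hkI
    (fun n r => by positivity)
    (fun n => integral_Icc_const_mul_le h.T_pos.le (norm_nonneg f) (h.memLp_k n).norm (h.k_le n))
    (fun ε hε => ?_) hs hst ht
  obtain ⟨δ, hδ, hδC⟩ : ∃ δ > 0, ∀ z : ℝ, |z| < δ → ‖u‖ * (C' * √|z|) < ε := by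
    have h1 : Tendsto (fun z : ℝ => ‖u‖ * (C' * √|z|)) (𝓝 0) (𝓝 0) := by
      have : Continuous fun z : ℝ => ‖u‖ * (C' * √|z|) := by fun_prop
      simpa using this.tendsto 0
    obtain ⟨δ, hδ, h⟩ := Metric.eventually_nhds_iff.1 (h1.eventually_lt_const hε)
    exact ⟨δ, hδ, fun z hz => h (by simpa using hz)⟩
  refine ⟨δ / 2, by positivity, fun a c ha hac hcT hδac => ?_⟩
  have ma : a ∈ Icc 0 T := ⟨ha, hac.trans hcT⟩
  have mc : c ∈ Icc 0 T := ⟨ha.trans hac, hcT⟩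
  refine ⟨fun n r => inner ℝ f (k n r) * inner ℝ (ContinuousLinearMap.adjoint i u) (D n a),
    fun n => (((hfk n).integrable one_le_two).intervalIntegrable_of_mem ma mc).mul_const _, ?_,
    fun n => Eventually.of_forall fun r hr => ?_⟩
  · simp only [intervalIntegral.integral_mul_const]
    refine (hk f a ma c mc).zero_mul_isBoundedUnder_le ?_
    exact isBoundedUnder_of ⟨_, fun n => hb n a ma⟩
  · simp only [Pi.mul_apply]
    rw [← mul_sub, abs_mul, mul_comm ε]
    have mr : r ∈ Icc 0 T := ⟨ha.trans hr.1.le, hr.2.trans hcT⟩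
    refine mul_le_mul (abs_real_inner_le_norm _ _) ?_ (abs_nonneg _) (by positivity)
    refine (hC' n u r mr a ma).trans (hδC _ ?_).le
    rw [abs_of_nonneg (by linarith [hr.1])]
    linarith [hr.2]

/-- Linearity treats the span of the rank one operators. An operator-norm error `ε` costs at most `ε
C ‖k n‖` in the integrand, which is uniformly integrable against the bound on `k`. -/
theorem tendsto_integral_const (h : IsControlledFamily i T κ R C₁ b D Z ψ d g β k η)
    (hk : ∀ f : U, ∀ s ∈ Icc 0 T, ∀ t ∈ Icc 0 T,
      Tendsto (fun n => ∫ r in s..t, inner ℝ f (k n r)) atTop (𝓝 0)) {A : U →L[ℝ] F}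
    (hA : A ∈ (regularRankOneSpan i).topologicalClosure) {s t : ℝ}
    (hs : 0 ≤ s) (hst : s ≤ t) (ht : t ≤ T) :
    Tendsto (fun n => ∫ r in s..t, inner ℝ (A (k n r)) (D n r)) atTop (𝓝 0) := by
  obtain ⟨C, hC0, hC, -⟩ := h.exists_bound
  have hspan : ∀ A ∈ regularRankOneSpan i, ∀ s t, 0 ≤ s → s ≤ t → t ≤ T →
      Tendsto (fun n => ∫ r in s..t, inner ℝ (A (k n r)) (D n r)) atTop (𝓝 0) := by
    intro A hA s t hs hst ht
    have ms : s ∈ Icc 0 T := ⟨hs, hst.trans ht⟩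
    have mt : t ∈ Icc 0 T := ⟨hs.trans hst, ht⟩
    induction hA using Submodule.span_induction with
    | mem A hA =>
      obtain ⟨p, rfl⟩ := hA
      refine (h.tendsto_integral_rankOne hk p.1 p.2 hs hst ht).congr fun n => ?_
      refine intervalIntegral.integral_congr fun r _ => ?_
      simp [real_inner_smul_left]
    | zero => simp
    | add A A' _ _ hA hA' =>
      have := hA.add hA'
      rw [add_zero] at this
      refine this.congr fun n => ?_
      rw [← intervalIntegral.integral_add (h.intervalIntegrable_inner_apply A n ms mt)
        (h.intervalIntegrable_inner_apply A' n ms mt)]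
      simp [inner_add_left]
    | smul c A _ hA =>
      have := hA.const_mul c
      rw [mul_zero] at this
      refine this.congr fun n => ?_
      rw [← intervalIntegral.integral_const_mul]
      simp [real_inner_smul_left]
  refine tendsto_integral_of_local_approx (v := fun n r => C * ‖k n r‖)
    (fun n => (h.memLp_inner_apply A n).integrable one_le_two)
    (fun n => ((h.memLp_k n).norm.integrable one_le_two).const_mul _)
    (fun n r => by positivity)
    (fun n => integral_Icc_const_mul_le h.T_pos.le hC0 (h.memLp_k n).norm (h.k_le n))
    (fun ε hε => ?_) hs hst ht
  obtain ⟨A', hA', hAA'⟩ := Metric.mem_closure_iff.1 hA ε hε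
  rw [dist_eq_norm] at hAA'
  -- The approximation of `A` by `A'` does not depend on time, so any `δ` serves.
  refine ⟨1, one_pos, fun a c ha hac hcT _ => ⟨fun n r => inner ℝ (A' (k n r)) (D n r),
    fun n => h.intervalIntegrable_inner_apply A' n ⟨ha, hac.trans hcT⟩ ⟨ha.trans hac, hcT⟩,
    hspan A' hA' a c ha hac hcT, fun n => Eventually.of_forall fun r hr => ?_⟩⟩
  rw [← inner_sub_left, ← sub_apply]
  calc _ ≤ ‖(A - A') (k n r)‖ * ‖D n r‖ := abs_real_inner_le_norm _ _
    _ ≤ (ε * ‖k n r‖) * C := by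
      gcongr
      · exact (A - A').le_of_opNorm_le hAA'.le _
      · exact hC n r ⟨ha.trans hr.1.le, hr.2.trans hcT⟩
    _ = _ := by ring

theorem tendsto_integral_coeff (h : IsControlledFamily i T κ R C₁ b D Z ψ d g β k η)
    (hk : ∀ f : U, ∀ s ∈ Icc 0 T, ∀ t ∈ Icc 0 T,
      Tendsto (fun n => ∫ r in s..t, inner ℝ f (k n r)) atTop (𝓝 0)) {S : Set ℝ}
    (hS : ∀ᵐ s ∂volume.restrict (Icc 0 T), s ∈ S)
    (hβc : ∀ s ∈ S, β s ∈ (regularRankOneSpan i).topologicalClosure)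
    (hβu : UniformContinuousOn β S) {s t : ℝ} (hs : 0 ≤ s) (hst : s ≤ t) (ht : t ≤ T) :
    Tendsto (fun n => ∫ r in s..t, inner ℝ (β r (k n r)) (D n r)) atTop (𝓝 0) := by
  obtain ⟨C, hC0, hC, -⟩ := h.exists_bound
  refine tendsto_integral_of_local_approx (v := fun n r => C * ‖k n r‖)
    h.integrable_inner_coeff
    (fun n => ((h.memLp_k n).norm.integrable one_le_two).const_mul _)
    (fun n r => by positivity)
    (fun n => integral_Icc_const_mul_le h.T_pos.le hC0 (h.memLp_k n).norm (h.k_le n))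
    (fun ε hε => ?_) hs hst ht
  obtain ⟨δ, hδ, hδβ⟩ := Metric.uniformContinuousOn_iff.1 hβu ε hε
  refine ⟨δ / 2, by positivity, fun a c ha hac hcT hδac => ?_⟩
  have hS' : ∀ᵐ r, r ∈ Ioc a c → r ∈ S := by
    rw [← ae_restrict_iff' measurableSet_Ioc]
    exact ae_mono (restrict_Ioc_le_restrict_Icc ha hcT) hS
  -- The coefficient is frozen at a point of `S`. As `S` has full measure, a piece that misses `S`
  -- is null, and the zero function is an approximant there.
  by_cases hne : ∃ p ∈ Ioc a c, p ∈ S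
  · obtain ⟨p, hp, hpS⟩ := hne
    refine ⟨fun n r => inner ℝ (β p (k n r)) (D n r),
      fun n => h.intervalIntegrable_inner_apply _ n ⟨ha, hac.trans hcT⟩ ⟨ha.trans hac, hcT⟩,
      h.tendsto_integral_const hk (hβc p hpS) ha hac hcT, fun n => ?_⟩
    filter_upwards [hS'] with r hrS hr
    have h1 : ‖β r - β p‖ ≤ ε := by
      rw [← dist_eq_norm]
      refine (hδβ r (hrS hr) p hpS ?_).le
      rw [Real.dist_eq, abs_lt]
      constructor <;> linarith [hr.1, hr.2, hp.1, hp.2]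
    rw [← inner_sub_left, ← sub_apply]
    calc _ ≤ ‖(β r - β p) (k n r)‖ * ‖D n r‖ := abs_real_inner_le_norm _ _
      _ ≤ (ε * ‖k n r‖) * C := by
        gcongr
        · exact (β r - β p).le_of_opNorm_le h1 _
        · exact hC n r ⟨ha.trans hr.1.le, hr.2.trans hcT⟩
      _ = _ := by ring
  · refine ⟨fun _ _ => 0, fun n => by simp, by simp, fun n => ?_⟩
    filter_upwards [hS'] with r hrS hr
    exact absurd ⟨r, hr, hrS hr⟩ hne

/-- The energy estimate reads `‖D‖² ≤ 2 |r| + ∫ q ‖D‖²`, where `r` collects the weakly null part of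
the force. Since `r` tends to zero uniformly in time, Grönwall's inequality makes `D` uniformly
small. -/
theorem eventually_norm_le (h : IsControlledFamily i T κ R C₁ b D Z ψ d g β k η)
    (hk : ∀ f : U, ∀ s ∈ Icc 0 T, ∀ t ∈ Icc 0 T,
      Tendsto (fun n => ∫ r in s..t, inner ℝ f (k n r)) atTop (𝓝 0)) {S : Set ℝ}
    (hS : ∀ᵐ s ∂volume.restrict (Icc 0 T), s ∈ S)
    (hβc : ∀ s ∈ S, β s ∈ (regularRankOneSpan i).topologicalClosure)
    (hβu : UniformContinuousOn β S) {ε : ℝ} (hε : 0 < ε) :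
    ∀ᶠ n in atTop, ∀ t ∈ Icc 0 T, ‖D n t‖ ≤ ε := by
  obtain ⟨C, hC0, hC, -⟩ := h.exists_bound
  have hT := h.T_pos
  have hκ := h.κ_pos
  have hC₁ := h.C₁_nonneg
  have hb := h.b_nonneg
  have hR : 0 ≤ R := (integral_nonneg fun s => sq_nonneg _).trans (h.η_le 0)
  have m0 : (0 : ℝ) ∈ Icc 0 T := ⟨le_rfl, hT.le⟩
  set r : ℕ → ℝ → ℝ := fun n t => ∫ s in (0 : ℝ)..t, inner ℝ (β s (k n s)) (D n s) with hr
  have hr0 : ∀ t ∈ Icc 0 T, Tendsto (fun n => r n t) atTop (𝓝 0) := fun t ht =>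
    h.tendsto_integral_coeff hk hS hβc hβu le_rfl ht.1 ht.2
  have hrH : ∀ n, ∀ s ∈ Icc 0 T, ∀ t ∈ Icc 0 T,
      |r n s - r n t| ≤ √((b * C) ^ 2 * R) * √|s - t| := by
    intro n s hs t ht
    rw [hr]
    simp only
    rw [intervalIntegral.integral_interval_sub_left
      ((h.integrable_inner_coeff n).intervalIntegrable_of_mem m0 hs)
      ((h.integrable_inner_coeff n).intervalIntegrable_of_mem m0 ht), abs_sub_comm,
      ← Real.norm_eq_abs]
    refine norm_intervalIntegral_le_sqrt (w := fun s => b * C * ‖k n s‖)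
      ((h.memLp_k n).norm.const_mul _) ?_ ?_ ht hs
    · simp only [mul_pow]
      rw [integral_const_mul]
      exact mul_le_mul_of_nonneg_left (h.k_le n) (by positivity)
    · filter_upwards [ae_restrict_mem measurableSet_Icc, h.β_le] with s hs hβ
      calc _ ≤ ‖β s (k n s)‖ * ‖D n s‖ := norm_inner_le_norm _ _
        _ ≤ (b * ‖k n s‖) * C := by
          gcongr
          · exact (β s).le_of_opNorm_le hβ _
          · exact hC n s hs
        _ = _ := by ring
  set c : ℝ := κ * ‖i‖ ^ 2 with hc
  set q : ℕ → ℝ → ℝ := fun n s => c + 2 * C₁ * η n s with hq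
  have hqL : ∀ n, MemLp (q n) 2 (volume.restrict (Icc 0 T)) := fun n =>
    (memLp_const c).add ((h.memLp_η n).const_mul _)
  set R₁ : ℝ := 2 * (c ^ 2 * T + (2 * C₁) ^ 2 * R) + 1 with hR₁
  have hR₁0 : 0 < R₁ := by positivity
  have hqR : ∀ n, ∫ s in Icc 0 T, q n s ^ 2 ≤ R₁ := by
    intro n
    have i1 : Integrable (fun _ : ℝ => c ^ 2) (volume.restrict (Icc 0 T)) := integrable_const _
    have i2 : Integrable (fun s => (2 * C₁) ^ 2 * η n s ^ 2) (volume.restrict (Icc 0 T)) :=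
      (h.memLp_η n).integrable_sq.const_mul _
    calc ∫ s in Icc 0 T, q n s ^ 2
        ≤ ∫ s in Icc 0 T, 2 * (c ^ 2 + (2 * C₁) ^ 2 * η n s ^ 2) := by
          refine integral_mono (hqL n).integrable_sq ((i1.add i2).const_mul 2) fun s => ?_
          simp only [hq]
          nlinarith [sq_nonneg (c - 2 * C₁ * η n s)]
      _ = 2 * (c ^ 2 * T + (2 * C₁) ^ 2 * (∫ s in Icc 0 T, η n s ^ 2)) := by
          rw [integral_const_mul, integral_add i1 i2, integral_const_mul]
          simp [hT.le, mul_comm]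
      _ ≤ R₁ := by
          have h1 := h.η_le n
          have : 2 * (c ^ 2 * T + (2 * C₁) ^ 2 * (∫ s in Icc 0 T, η n s ^ 2))
              ≤ 2 * (c ^ 2 * T + (2 * C₁) ^ 2 * R) := by gcongr
          linarith
  have hD2 : ∀ n, Continuous fun s => ‖D n s‖ ^ 2 := fun n => (h.path n).cont.norm.pow 2
  have hqD : ∀ n, Integrable (fun s => q n s * ‖D n s‖ ^ 2) (volume.restrict (Icc 0 T)) := fun n =>
    (hqL n).integrable_mul ((hD2 n).memLp_restrict_Icc 0 T 2)
  have key : ∀ n, ∀ t ∈ Icc 0 T, ‖D n t‖ ^ 2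
      ≤ 2 * |r n t| + ∫ s in (0 : ℝ)..t, q n s * ‖D n s‖ ^ 2 := by
    intro n t ht
    have h1 := (h.path n).norm_sq_add_le h.inj h.dense hκ (h.mono n) ht
    have hg : Integrable (fun s => inner ℝ (g n s) (D n s)) (volume.restrict (Icc 0 T)) := by
      refine Integrable.mono' (g := fun s => ‖g n s‖ * ‖D n s‖)
        ((h.path n).integrable_force.norm.mul_of_top_left
          ((h.path n).cont.norm.memLp_restrict_Icc 0 T ⊤))
        ((h.path n).integrable_force.aestronglyMeasurable.inner (h.path n).cont.aestronglyMeasurable)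
        (Eventually.of_forall fun s => norm_inner_le_norm _ _)
    have hβ2 : Integrable (fun s => 2 * inner ℝ (β s (k n s)) (D n s))
        (volume.restrict (Icc 0 T)) := (h.integrable_inner_coeff n).const_mul 2
    have h2 : ∫ s in (0 : ℝ)..t, (c * ‖D n s‖ ^ 2 + 2 * inner ℝ (g n s) (D n s))
        ≤ ∫ s in (0 : ℝ)..t,
          (2 * inner ℝ (β s (k n s)) (D n s) + q n s * ‖D n s‖ ^ 2) := by
      refine intervalIntegral.integral_mono_ae_restrict ht.1
        (((((hD2 n).memLp_restrict_Icc 0 T 1).integrable le_rfl).const_mul c).add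
          (hg.const_mul 2) |>.intervalIntegrable_of_mem m0 ht)
        ((hβ2.add (hqD n)).intervalIntegrable_of_mem m0 ht) ?_
      have hle : volume.restrict (Icc 0 t) ≤ (volume.restrict (Icc 0 T) : Measure ℝ) :=
        Measure.restrict_mono (Icc_subset_Icc_right ht.2) le_rfl
      filter_upwards [ae_mono hle (h.force n)] with s hs
      have h3 : inner ℝ (g n s) (D n s) = inner ℝ (g n s - β s (k n s)) (D n s)
          + inner ℝ (β s (k n s)) (D n s) := by rw [← inner_add_left]; simp
      have h4 : inner ℝ (g n s - β s (k n s)) (D n s) ≤ C₁ * ‖D n s‖ * η n s * ‖D n s‖ :=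
        (real_inner_le_norm _ _).trans (by gcongr)
      simp only [hq]
      nlinarith
    rw [intervalIntegral.integral_add (hβ2.intervalIntegrable_of_mem m0 ht)
      ((hqD n).intervalIntegrable_of_mem m0 ht), intervalIntegral.integral_const_mul] at h2
    have h3 : 0 ≤ κ⁻¹ * ∫ s in (0 : ℝ)..t, ‖ψ n s‖ ^ 2 :=
      mul_nonneg (inv_pos.2 hκ).le (intervalIntegral.integral_nonneg ht.1 fun s _ => sq_nonneg _)
    have h4 := le_abs_self (r n t)
    simp only [hr] at h4 ⊢
    linarith
  -- Chosen so that Grönwall's bound with `A = 2 ε² / √X` is exactly `ε⁴`.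
  set X : ℝ := 8 * Real.exp (2 * R₁ * T) with hX
  have hX0 : 0 < X := by positivity
  filter_upwards [eventually_forall_abs_le_of_holder hr0 hrH
    (show 0 < ε ^ 2 / √X by positivity)] with n hn t ht
  have h1 := sq_le_of_le_add_integral_mul (A := 2 * (ε ^ 2 / √X)) (hD2 n) (hqL n) hR₁0 (hqR n)
    (fun t _ => sq_nonneg _) (fun t ht => (key n t ht).trans (by gcongr; exact hn t ht)) t ht
  have h2 : 2 * (2 * (ε ^ 2 / √X)) ^ 2 * Real.exp (2 * R₁ * T) = (ε ^ 2) ^ 2 := by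
    rw [mul_pow, div_pow, Real.sq_sqrt hX0.le, hX]
    field_simp
    norm_num
  rw [h2] at h1
  exact (sq_le_sq₀ (norm_nonneg _) hε.le).1
    ((sq_le_sq₀ (sq_nonneg _) (sq_nonneg _)).1 h1)

end IsControlledFamily

end Convergence

/-! ### Finite rank approximation of Hilbert–Schmidt operators -/

section HilbertSchmidt

variable {H₁ H₂ : Type*} [NormedAddCommGroup H₁] [InnerProductSpace ℝ H₁]
  [NormedAddCommGroup H₂] [NormedSpace ℝ H₂]

/-- Cauchy–Schwarz and Bessel's inequality bound the remainder of the expansion of `A x` by `‖x‖`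
times the `ℓ²` tail of `‖A (b j)‖`. The empty `t` gives the comparison of operator and
Hilbert–Schmidt norms. -/
theorem HilbertBasis.norm_sub_sum_rankOne_le {ι : Type*} (b : HilbertBasis ι ℝ H₁)
    (A : H₁ →L[ℝ] H₂) {c : ℝ} (hc : 0 ≤ c) {t : Finset ι}
    (h : ∀ t', Disjoint t' t → ∑ j ∈ t', ‖A (b j)‖ ^ 2 ≤ c ^ 2) :
    ‖A - ∑ j ∈ t, (innerSL ℝ (b j)).smulRight (A (b j))‖ ≤ c := by
  classical
  refine ContinuousLinearMap.opNorm_le_bound _ hc fun x => ?_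
  have h1 : HasSum (fun j => inner ℝ (b j) x • A (b j)) (A x) := by
    have := (b.hasSum_repr x).mapL A
    simpa [b.repr_apply_apply] using this
  have h2 : Tendsto (fun t' : Finset ι => ‖∑ j ∈ t', inner ℝ (b j) x • A (b j)
      - ∑ j ∈ t, inner ℝ (b j) x • A (b j)‖) atTop
      (𝓝 ‖A x - ∑ j ∈ t, inner ℝ (b j) x • A (b j)‖) :=
    (Tendsto.sub_const h1 _).norm
  have h3 : (A - ∑ j ∈ t, (innerSL ℝ (b j)).smulRight (A (b j))) x
      = A x - ∑ j ∈ t, inner ℝ (b j) x • A (b j) := by simp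
  rw [h3]
  refine le_of_tendsto h2 ?_
  filter_upwards [eventually_ge_atTop t] with t' ht'
  rw [← Finset.sum_sdiff (show t ⊆ t' from ht'), add_sub_cancel_right]
  have h4 : ‖∑ j ∈ t' \ t, inner ℝ (b j) x • A (b j)‖
      ≤ ∑ j ∈ t' \ t, ‖inner ℝ (b j) x‖ * ‖A (b j)‖ :=
    norm_sum_le_of_le _ fun j _ => (norm_smul _ _).le
  have h5 := Finset.sum_mul_sq_le_sq_mul_sq (t' \ t) (fun j => ‖inner ℝ (b j) x‖)
    (fun j => ‖A (b j)‖)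
  have h6 := b.orthonormal.sum_inner_products_le x (s := t' \ t)
  have h7 := h (t' \ t) Finset.sdiff_disjoint
  refine h4.trans (abs_le_of_sq_le_sq' ?_ (by positivity)).2
  refine h5.trans ?_
  rw [mul_pow, mul_comm]
  exact mul_le_mul h7 h6 (Finset.sum_nonneg fun j _ => sq_nonneg _) (sq_nonneg c)

/-- Unfolds `hsNorm` into real finite sums; the basis is the one fixed by its definition, hence the
same for all operators. -/
theorem exists_hilbertBasis_sum_sq_le_of_hsNorm_le [CompleteSpace H₁] :
    ∃ (w : Set H₁) (b : HilbertBasis w ℝ H₁), ∀ (A : H₁ →L[ℝ] H₂) (c : ℝ), 0 ≤ c →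
      hsNorm A ≤ ENNReal.ofReal c → ∀ t : Finset w, ∑ j ∈ t, ‖A (b j)‖ ^ 2 ≤ c ^ 2 := by
  obtain ⟨b, hb⟩ := (exists_hilbertBasis ℝ H₁).choose_spec
  refine ⟨(exists_hilbertBasis ℝ H₁).choose, b, fun A c hc h t => ?_⟩
  have h1 : ∑' e : (exists_hilbertBasis ℝ H₁).choose, ‖A e‖ₑ ^ 2 ≤ ENNReal.ofReal (c ^ 2) := by
    have h2 := ENNReal.rpow_le_rpow h (show (0 : ℝ) ≤ 2 by norm_num)
    rw [hsNorm, ← ENNReal.rpow_mul] at h2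
    norm_num at h2
    rwa [← ENNReal.ofReal_pow hc] at h2
  have h3 := (ENNReal.sum_le_tsum t).trans h1
  rw [← ENNReal.ofReal_le_ofReal_iff (sq_nonneg c), ENNReal.ofReal_sum_of_nonneg
    fun j _ => sq_nonneg _]
  refine le_of_eq_of_le (Finset.sum_congr rfl fun j _ => ?_) h3
  rw [hb, ENNReal.ofReal_pow (norm_nonneg _), ofReal_norm]

theorem norm_le_of_hsNorm_le [CompleteSpace H₁] {A : H₁ →L[ℝ] H₂} {c : ℝ} (hc : 0 ≤ c)
    (h : hsNorm A ≤ ENNReal.ofReal c) : ‖A‖ ≤ c := by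
  obtain ⟨w, b, hb⟩ := exists_hilbertBasis_sum_sq_le_of_hsNorm_le (H₁ := H₁) (H₂ := H₂)
  simpa using b.norm_sub_sum_rankOne_le A hc (t := ∅) fun t' _ => hb A c hc h t'

theorem hsNorm_comp_linearIsometry [CompleteSpace H₁] {H₃ : Type*} [NormedAddCommGroup H₃]
    [NormedSpace ℝ H₃] (J : H₂ →ₗᵢ[ℝ] H₃) (A : H₁ →L[ℝ] H₂) :
    hsNorm (J.toContinuousLinearMap ∘L A) = hsNorm A := by
  simp only [hsNorm, ContinuousLinearMap.comp_apply, LinearIsometry.coe_toContinuousLinearMap,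
    enorm, J.nnnorm_map]

/-- Hilbert-Schmidt operators are norm limits of finite rank operators with regular range. -/
theorem mem_closure_regularRankOneSpan {F U : Type*} [NormedAddCommGroup F]
    [InnerProductSpace ℝ F] [CompleteSpace F] [NormedAddCommGroup U] [InnerProductSpace ℝ U]
    [CompleteSpace U] {i : F →L[ℝ] U} (hi : Function.Injective i) {A : U →L[ℝ] F}
    {c : ℝ} (hc : 0 ≤ c) (hA : hsNorm A ≤ ENNReal.ofReal c) :
    A ∈ (regularRankOneSpan i).topologicalClosure := by
  obtain ⟨w, b, hb⟩ := exists_hilbertBasis_sum_sq_le_of_hsNorm_le (H₁ := U) (H₂ := F)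
  -- The range of `i*` is dense in `F`, so an arbitrary target vector is allowed in the closure.
  have hr : ∀ (f : U) (y : F),
      (innerSL ℝ f).smulRight y ∈ (regularRankOneSpan i).topologicalClosure := fun f y => by
    refine map_mem_closure (t := regularRankOneSpan i)
      (ContinuousLinearMap.smulRightL ℝ U F (innerSL ℝ f)).continuous
      (denseRange_adjoint hi y) ?_
    rintro _ ⟨u, rfl⟩
    exact Submodule.subset_span ⟨(f, u), rfl⟩
  have hs : Summable fun j => ‖A (b j)‖ ^ 2 :=
    summable_of_sum_le (fun j => sq_nonneg _) (hb A c hc hA)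
  rw [← SetLike.mem_coe, ← (Submodule.isClosed_topologicalClosure _).closure_eq,
    Metric.mem_closure_iff]
  intro ε hε
  obtain ⟨t, ht⟩ := summable_iff_vanishing_norm.1 hs ((ε / 2) ^ 2) (by positivity)
  refine ⟨∑ j ∈ t, (innerSL ℝ (b j)).smulRight (A (b j)),
    Submodule.sum_mem _ fun j _ => hr _ _, ?_⟩
  rw [dist_eq_norm]
  refine (b.norm_sub_sum_rankOne_le A (half_pos hε).le fun t' ht' => ?_).trans_lt (half_lt_self hε)
  exact (le_abs_self _).trans (ht t' ht').le

end HilbertSchmidt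

/-! ### The triple of the semigroup -/

/-- A function of exponential decay is zero at the origin if the Abel transforms of all its
translates vanish. -/
theorem eq_zero_of_abel {X : Type*} [NormedAddCommGroup X] [NormedSpace ℝ X] [CompleteSpace X]
    {f : ℝ → X} {C : ℝ} (hC : 0 ≤ C) (hf : Continuous f) (hfb : ∀ t, ‖f t‖ ≤ C * Real.exp (-t))
    (h0 : ∀ a, 0 ≤ a → ∫ t in Ioi (0 : ℝ), t ^ (-(1 / 2) : ℝ) • f (a + t) = 0) : f 0 = 0 := by
  -- If all tail integrals vanish, so does the primitive of `f` on the half-line, whose right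
  -- derivative at 0 is `f 0`.
  have htail : ∀ a, 0 ≤ a → ∫ t in Ioi a, f t = 0 := by
    intro a ha
    have h1 : ∫ t in Ioi (0 : ℝ), f (a + t) = 0 := by
      refine integral_eq_zero_of_abel (C := C) (f := fun t => f (a + t)) (by fun_prop)
        (fun t ht => (hfb _).trans ?_) fun s hs => ?_
      · gcongr
        linarith
      · simp only [← add_assoc]
        exact h0 (a + s) (by linarith)
    have h2 := (measurePreserving_add_left volume a).setIntegral_preimage_emb
      (measurableEmbedding_addLeft a) f (Ioi a)
    rw [← h2, ← h1]
    simp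
  have hfi : ∀ a, IntegrableOn f (Ioi a) := fun a =>
    ((integrableOn_exp_neg_Ioi a).const_mul C).mono' hf.aestronglyMeasurable
      (Eventually.of_forall hfb)
  have hint : ∀ a, 0 ≤ a → ∫ t in (0 : ℝ)..a, f t = 0 := fun a ha => by
    rw [← intervalIntegral.integral_Ioi_sub_Ioi (hfi 0) ha, htail 0 le_rfl, htail a ha, sub_zero]
  have hd : HasDerivWithinAt (fun a => ∫ t in (0 : ℝ)..a, f t) (f 0) (Ici 0) 0 :=
    (intervalIntegral.integral_hasDerivAt_right (hf.intervalIntegrable _ _)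
      hf.stronglyMeasurable.stronglyMeasurableAtFilter hf.continuousAt).hasDerivWithinAt
  have hd' : HasDerivWithinAt (fun a => ∫ t in (0 : ℝ)..a, f t) 0 (Ici 0) 0 :=
    (hasDerivWithinAt_const (0 : ℝ) (Ici 0) (0 : X)).congr (fun a ha => hint a ha)
      (hint 0 le_rfl)
  exact (uniqueDiffWithinAt_Ici (0 : ℝ)).eq_deriv _ hd hd'

namespace SubMarkovianSemigroup

variable {E : Type*} [MeasurableSpace E] {μ : Measure E} (P : SubMarkovianSemigroup μ)

/-- Testing with `P_a u` in place of `u` shows that all translates of `t ↦ e^{-t} ⟨w, P_t u⟩` have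
vanishing Abel transform, so its value `⟨w, u⟩` at 0 vanishes. This gives density of `F_{1,2}` in
`L²(μ)`. -/
theorem eq_zero_of_inner_bessel_eq_zero {w : Lp ℝ 2 μ}
    (hw : ∀ u, inner ℝ w (P.bessel u) = 0) : w = 0 := by
  refine ext_inner_right ℝ fun u => ?_
  rw [inner_zero_left]
  set f : ℝ → ℝ := fun t => Real.exp (-t) * inner ℝ w (P.op t.toNNReal u) with hf
  have h0 : f 0 = 0 := by
    refine eq_zero_of_abel (C := ‖w‖ * ‖u‖) (by positivity) ?_ (fun t => ?_) fun a ha => ?_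
    · exact (by fun_prop : Continuous fun t : ℝ => Real.exp (-t)).mul
        (continuous_const.inner (P.continuous_orbit u))
    · rw [hf, norm_mul, Real.norm_of_nonneg (Real.exp_pos _).le, mul_comm]
      gcongr
      exact (abs_real_inner_le_norm _ _).trans
        (mul_le_mul_of_nonneg_left (P.norm_op_apply_le _ _) (norm_nonneg w))
    · have h1 := hw (P.op a.toNNReal u)
      rw [bessel_apply, gammaTransform, real_inner_smul_right, mul_eq_zero] at h1
      have h2 := h1.resolve_left
        (inv_ne_zero (Real.Gamma_pos_of_pos (by norm_num : (0 : ℝ) < 1 / 2)).ne')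
      rw [← integral_inner (P.integrableOn_gammaTransform one_pos _),
        show (1 / 2 - 1 : ℝ) = -(1 / 2) by norm_num] at h2
      have h3 := congrArg (fun z => Real.exp (-a) * z) h2
      simp only [mul_zero, ← integral_const_mul] at h3
      refine Eq.trans ?_ h3
      refine setIntegral_congr_fun measurableSet_Ioi fun t ht => ?_
      have ht : (0 : ℝ) < t := ht
      simp only [hf, smul_eq_mul]
      rw [add_comm a t, Real.toNNReal_add ht.le ha, P.op_add, ContinuousLinearMap.comp_apply,
        real_inner_smul_right, neg_add, Real.exp_add]
      ring
  simpa [hf, P.op_zero] using h0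

namespace F12

theorem incl_injective : Function.Injective (incl P) := Subtype.coe_injective

theorem denseRange_incl : DenseRange (incl P) := by
  have h : ((incl P).range).topologicalClosure = ⊤ := by
    rw [Submodule.topologicalClosure_eq_top_iff, Submodule.eq_bot_iff]
    intro w hw
    refine P.eq_zero_of_inner_bessel_eq_zero fun u => ?_
    rw [real_inner_comm, ← incl_besselEquiv]
    exact hw _ ⟨besselEquiv P u, rfl⟩
  rw [← Submodule.dense_iff_topologicalClosure_eq_top] at h
  exact h

instance : CompleteSpace P.F12 :=
  (LinearIsometryEquiv.mk (besselEquiv P).symm fun f => (norm_eq P f).symm).toIsometryEquiv.completeSpace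

end F12

namespace F12Dual

/-- The Riesz identification of `F*_{1,2}` with `F_{1,2}`. -/
noncomputable def rieszSymm : P.F12Dual ≃ₗᵢ[ℝ] P.F12 :=
  (functional P).trans (InnerProductSpace.toDual ℝ P.F12).symm

theorem inner_rieszSymm (η : P.F12Dual) (f : P.F12) :
    inner ℝ (rieszSymm P η) f = functional P η f :=
  InnerProductSpace.toDual_symm_apply

theorem rieszSymm_embed (u : Lp ℝ 2 μ) :
    rieszSymm P (P.embed u) = ContinuousLinearMap.adjoint (F12.incl P) u := by
  refine ext_inner_right ℝ fun f => ?_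
  rw [inner_rieszSymm, embed_apply, ContinuousLinearMap.adjoint_inner_left]

/-- Together with `rieszSymm_embed`, this turns the skeleton equation into the form required by
`IsTriplePath`. -/
theorem rieszSymm_extL (f : P.F12) : rieszSymm P (P.extL f)
    = ContinuousLinearMap.adjoint (F12.incl P) (F12.incl P f) - f := by
  refine ext_inner_right ℝ fun g => ?_
  rw [inner_rieszSymm, extL_apply, inner_sub_left, ContinuousLinearMap.adjoint_inner_left]

end F12Dual

end SubMarkovianSemigroup

/-! ### Weak convergence, the nonlinearity and the noise coefficient -/

/-- Weak convergence is tested against the step function equal to `f` on `(s, t]`. -/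
theorem tendsto_integral_inner_of_weak {X : Type*} [NormedAddCommGroup X] [InnerProductSpace ℝ X]
    [CompleteSpace X] {T : ℝ} {hn : ℕ → Lp X 2 ((volume : Measure ℝ).restrict (Icc 0 T))}
    {h : Lp X 2 ((volume : Measure ℝ).restrict (Icc 0 T))}
    (hweak : Tendsto
      (fun n => toWeakSpace ℝ (Lp X 2 ((volume : Measure ℝ).restrict (Icc 0 T))) (hn n)) atTop
      (𝓝 (toWeakSpace ℝ (Lp X 2 ((volume : Measure ℝ).restrict (Icc 0 T))) h)))
    (f : X) {s t : ℝ} (hs : s ∈ Icc 0 T) (ht : t ∈ Icc 0 T) :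
    Tendsto (fun n => ∫ r in s..t, inner ℝ f (hn n r - h r)) atTop (𝓝 0) := by
  wlog hst : s ≤ t generalizing s t
  · simp only [intervalIntegral.integral_symm t s]
    simpa using (this ht hs (le_of_not_ge hst)).neg
  have hfin : (volume.restrict (Icc 0 T) : Measure ℝ) (Ioc s t) ≠ ∞ := measure_ne_top _ _
  set v : Lp X 2 (volume.restrict (Icc 0 T) : Measure ℝ) :=
    indicatorConstLp 2 measurableSet_Ioc hfin f with hv
  have h1 : Tendsto (fun n => inner ℝ v (hn n)) atTop (𝓝 (inner ℝ v h)) :=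
    ((WeakBilin.eval_continuous (topDualPairing ℝ (Lp X 2
      (volume.restrict (Icc 0 T) : Measure ℝ))).flip (innerSL ℝ v)).tendsto
      (toWeakSpace ℝ (Lp X 2 (volume.restrict (Icc 0 T) : Measure ℝ)) h)).comp hweak
  have hm : (volume.restrict (Icc 0 T) : Measure ℝ).restrict (Ioc s t)
      = volume.restrict (Ioc s t) := by
    rw [Measure.restrict_restrict measurableSet_Ioc,
      inter_eq_left.2 (Ioc_subset_Icc_self.trans (Icc_subset_Icc hs.1 ht.2))]
  have h2 : ∀ k : Lp X 2 (volume.restrict (Icc 0 T) : Measure ℝ),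
      inner ℝ v k = ∫ r in s..t, inner ℝ f (k r) := fun k => by
    rw [hv, L2.inner_indicatorConstLp_eq_setIntegral_inner, hm,
      intervalIntegral.integral_of_le hst]
  have h3 := h1.sub_const (inner ℝ v h)
  rw [sub_self] at h3
  refine h3.congr fun n => ?_
  have hI : ∀ k : Lp X 2 (volume.restrict (Icc 0 T) : Measure ℝ),
      IntervalIntegrable (fun r => inner ℝ f (k r)) volume s t := fun k =>
    ((innerSL ℝ f).integrable_comp ((Lp.memLp k).integrable one_le_two)).intervalIntegrable_of_mem
      hs ht
  rw [h2, h2, ← intervalIntegral.integral_sub (hI _) (hI _)]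
  simp only [inner_sub_right]

/-- Pointwise, `|Ψ a - Ψ b|² ≤ K |a - b| |Ψ a - Ψ b|`, and monotonicity removes the absolute values
from the product. The constant `K + 1` is positive even when `K = 0`. -/
theorem norm_compLp_sub_sq_le {E : Type*} [MeasurableSpace E] {μ : Measure E} {Ψ : ℝ → ℝ}
    (hΨmono : Monotone Ψ) {K : ℝ≥0} (hΨ : LipschitzWith K Ψ) (hΨ0 : Ψ 0 = 0) (u v : Lp ℝ 2 μ) :
    ‖hΨ.compLp hΨ0 u - hΨ.compLp hΨ0 v‖ ^ 2
      ≤ ((K : ℝ) + 1) * inner ℝ (hΨ.compLp hΨ0 u - hΨ.compLp hΨ0 v) (u - v) := by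
  have hr : ∀ a b : ℝ, (Ψ a - Ψ b) * (Ψ a - Ψ b) ≤ ((K : ℝ) + 1) * ((a - b) * (Ψ a - Ψ b)) := by
    intro a b
    have h1 : |Ψ a - Ψ b| ≤ K * |a - b| := by
      simpa [Real.dist_eq] using hΨ.dist_le_mul a b
    have h2 : 0 ≤ (a - b) * (Ψ a - Ψ b) := by
      rcases le_total a b with h | h
      · exact mul_nonneg_of_nonpos_of_nonpos (by linarith) (by linarith [hΨmono h])
      · exact mul_nonneg (by linarith) (by linarith [hΨmono h])
    rw [← abs_mul_abs_self (Ψ a - Ψ b), ← abs_of_nonneg h2, abs_mul]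
    nlinarith [abs_nonneg (Ψ a - Ψ b), abs_nonneg (a - b)]
  rw [← real_inner_self_eq_norm_sq, L2.inner_def, L2.inner_def, ← integral_const_mul]
  refine integral_mono_ae (L2.integrable_inner _ _) ((L2.integrable_inner _ _).const_mul _) ?_
  filter_upwards [Lp.coeFn_sub (hΨ.compLp hΨ0 u) (hΨ.compLp hΨ0 v), Lp.coeFn_sub u v,
    hΨ.coeFn_compLp hΨ0 u, hΨ.coeFn_compLp hΨ0 v] with z h1 h2 h3 h4
  rw [h1, h2, Pi.sub_apply, Pi.sub_apply, h3, h4]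
  simpa [sq] using hr (u z) (v z)

section Coefficient

variable {E : Type*} [MeasurableSpace E] {μ : Measure E} {P : SubMarkovianSemigroup μ}

theorem NoiseCoefficient.norm_sub_le {T : ℝ} {B : ℝ → Lp ℝ 2 μ → (Lp ℝ 2 μ →L[ℝ] P.F12Dual)}
    (hB : NoiseCoefficient P T B) : ∃ C₁ : ℝ, 0 ≤ C₁ ∧ ∀ t ∈ Icc 0 T, ∀ u v,
      ‖B t u - B t v‖ ≤ C₁ * ‖P.embed u - P.embed v‖ := by
  obtain ⟨C₁, hC₁, h⟩ := hB.lipschitz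
  exact ⟨C₁, hC₁, fun t ht u v => norm_le_of_hsNorm_le (by positivity) (h t ht u v)⟩

/-- Along a path of the triple the noise coefficient is uniformly continuous. -/
theorem NoiseCoefficient.uniformContinuousOn {T : ℝ}
    {B : ℝ → Lp ℝ 2 μ → (Lp ℝ 2 μ →L[ℝ] P.F12Dual)} (hB : NoiseCoefficient P T B)
    {y : ℝ → Lp ℝ 2 μ} {Y : ℝ → P.F12Dual} (hY : Continuous Y) {S : Set ℝ} (hST : S ⊆ Icc 0 T)
    (hS : ∀ s ∈ S, Y s = P.embed (y s)) : UniformContinuousOn (fun s => B s (y s)) S := by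
  obtain ⟨C₁, hC₁, h1⟩ := hB.norm_sub_le
  obtain ⟨γ, hγ, C, hC, h2⟩ := hB.holder
  obtain ⟨R, hR⟩ := isCompact_Icc.exists_bound_of_continuousOn (hY.continuousOn (s := Icc 0 T))
  have hYu : UniformContinuousOn Y S :=
    (isCompact_Icc.uniformContinuousOn_of_continuous hY.continuousOn).mono hST
  rw [Metric.uniformContinuousOn_iff] at hYu ⊢
  intro ε hε
  obtain ⟨δ₁, hδ₁, H₁⟩ := hYu (ε / 2 / (C₁ + 1)) (by positivity)
  obtain ⟨δ₂, hδ₂, H₂⟩ : ∃ δ > 0, ∀ z : ℝ, |z| < δ → C * (|R| + 1) * |z| ^ γ < ε / 2 := by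
    have h3 : Tendsto (fun z : ℝ => C * (|R| + 1) * |z| ^ γ) (𝓝 0) (𝓝 0) := by
      have : Continuous fun z : ℝ => C * (|R| + 1) * |z| ^ γ :=
        continuous_const.mul (continuous_abs.rpow_const fun _ => Or.inr hγ.le)
      simpa [Real.zero_rpow hγ.ne'] using this.tendsto 0
    obtain ⟨δ, hδ, h⟩ := Metric.eventually_nhds_iff.1
      (h3.eventually_lt_const (show 0 < ε / 2 by positivity))
    exact ⟨δ, hδ, fun z hz => h (by simpa using hz)⟩
  refine ⟨min δ₁ δ₂, lt_min hδ₁ hδ₂, fun s hs t ht hst => ?_⟩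
  -- First the state is changed at a fixed time, where continuity of `Y` in the dual norm enters
  -- because `Y = embed y` on `S`; then the time is changed at a fixed state.
  have h3 : ‖B s (y s) - B s (y t)‖ ≤ C₁ * (ε / 2 / (C₁ + 1)) := by
    refine (h1 s (hST hs) _ _).trans ?_
    rw [← hS s hs, ← hS t ht, ← dist_eq_norm]
    gcongr
    exact (H₁ s hs t ht (hst.trans_le (min_le_left _ _))).le
  have h4 : ‖B s (y t) - B t (y t)‖ < ε / 2 := by
    refine (norm_le_of_hsNorm_le (by positivity) (h2 s (hST hs) t (hST ht) (y t))).trans_lt ?_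
    refine lt_of_le_of_lt ?_ (H₂ (s - t) (by
      rw [← Real.dist_eq]; exact hst.trans_le (min_le_right _ _)))
    gcongr
    rw [← hS t ht]
    exact (hR t (hST ht)).trans (le_abs_self R)
  have h5 : C₁ * (ε / 2 / (C₁ + 1)) ≤ ε / 2 := by
    rw [mul_div_assoc', div_le_iff₀ (by positivity)]
    nlinarith
  rw [dist_eq_norm]
  calc _ = ‖(B s (y s) - B s (y t)) + (B s (y t) - B t (y t))‖ := by rw [sub_add_sub_cancel]
    _ ≤ _ := norm_add_le _ _
    _ < ε := by linarith

end Coefficient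

/-! ### The skeleton equation as a controlled family -/

theorem theorem5p2 {E : Type*} [MeasurableSpace E] [StandardBorelSpace E]
    (μ : Measure E) [SigmaFinite μ]
    (P : SubMarkovianSemigroup μ)
    (hL : IsSelfAdjoint P.generator)
    (hLneg : ∀ u : P.generator.domain, inner ℝ (P.generator u) (u : Lp ℝ 2 μ) ≤ 0)
    (Ψ : ℝ → ℝ) (hΨmono : Monotone Ψ) (K : ℝ≥0) (hΨ : LipschitzWith K Ψ) (hΨ0 : Ψ 0 = 0)
    (T : ℝ) (hT : 0 < T)
    (B : ℝ → Lp ℝ 2 μ → (Lp ℝ 2 μ →L[ℝ] P.F12Dual)) (hB : NoiseCoefficient P T B)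
    (x : Lp ℝ 2 μ) (M : ℝ)
    (h : L2Path T μ) (hh : h ∈ controlBall T μ M)
    (hn : ℕ → L2Path T μ) (hhn : ∀ n, hn n ∈ controlBall T μ M)
    (hweak : Tendsto (fun n => toWeakSpace ℝ (L2Path T μ) (hn n)) atTop
      (𝓝 (toWeakSpace ℝ (L2Path T μ) h)))
    (Y : C(Icc 0 T, P.F12Dual)) (hY : IsSkeletonSolution P hΨ hΨ0 T B (P.embed x) h Y)
    (Yn : ℕ → C(Icc 0 T, P.F12Dual))
    (hYn : ∀ n, IsSkeletonSolution P hΨ hΨ0 T B (P.embed x) (hn n) (Yn n)) :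
    Tendsto Yn atTop (𝓝 Y) := by
  obtain ⟨y, Z, hy, hZ, hBI, heq⟩ := hY
  choose yn Zn hyn hZn hBIn heqn using hYn
  set i := SubMarkovianSemigroup.F12.incl P with hi
  set J := SubMarkovianSemigroup.F12Dual.rieszSymm P with hJ
  obtain ⟨C₁, hC₁, hlip⟩ := hB.norm_sub_le
  obtain ⟨C₂, hC₂, hgr⟩ := hB.growth
  -- Paths are extended from `[0, T]` to the real line by their endpoint values, which keeps them
  -- continuous.
  set pr : ℝ → Icc 0 T := projIcc 0 T hT.le with hpr
  have hprc : Continuous pr := continuous_projIcc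
  have hprm : ∀ t (ht : t ∈ Icc 0 T), pr t = ⟨t, ht⟩ := fun t ht => projIcc_of_mem hT.le ht
  have hyE : ∀ᵐ s ∂volume.restrict (Icc 0 T), Y (pr s) = P.embed (y s) := by
    rw [ae_restrict_iff' measurableSet_Icc]
    filter_upwards [hy] with s hs hsm
    rw [hprm s hsm, hs hsm]
  have hynE : ∀ n, ∀ᵐ s ∂volume.restrict (Icc 0 T), Yn n (pr s) = P.embed (yn n s) := fun n => by
    rw [ae_restrict_iff' measurableSet_Icc]
    filter_upwards [hyn n] with s hs hsm
    rw [hprm s hsm, hs hsm]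
  set S : Set ℝ := {s | s ∈ Icc 0 T ∧ Y (pr s) = P.embed (y s)} with hS
  have hSae : ∀ᵐ s ∂volume.restrict (Icc 0 T), s ∈ S := by
    filter_upwards [hyE, ae_restrict_mem measurableSet_Icc] with s h1 h2 using ⟨h2, h1⟩
  have hYc : Continuous fun s => Y (pr s) := Y.continuous.comp hprc
  set b : ℝ := C₂ * (‖Y‖ + 1) with hb
  have hb0 : 0 ≤ b := by positivity
  set β : ℝ → Lp ℝ 2 μ →L[ℝ] P.F12 := fun s =>
    J.toLinearIsometry.toContinuousLinearMap ∘L B s (y s) with hβ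
  have hβhs : ∀ s ∈ S, hsNorm (β s) ≤ ENNReal.ofReal b := fun s hs => by
    rw [hβ, hsNorm_comp_linearIsometry]
    refine (hgr s hs.1 (y s)).trans (ENNReal.ofReal_le_ofReal ?_)
    rw [← hs.2, hb]
    gcongr
    exact Y.norm_coe_le_norm _
  have hβu : UniformContinuousOn β S := by
    have h1 := hB.uniformContinuousOn hYc (S := S) (fun s hs => hs.1) (fun s hs => hs.2)
    exact (ContinuousLinearMap.compL ℝ (Lp ℝ 2 μ) P.F12Dual P.F12
      J.toLinearIsometry.toContinuousLinearMap).uniformContinuous.comp_uniformContinuousOn h1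
  -- Measurability in time is not assumed of `B`; along the limit path it follows from continuity on
  -- a measurable subset of `S` of full measure.
  have hβm : AEStronglyMeasurable β (volume.restrict (Icc 0 T)) := by
    obtain ⟨S', hS', hS'm, hS'S⟩ := hSae.exists_measurable_mem
    rw [← Measure.restrict_eq_self_of_ae_mem hS']
    exact (hβu.continuousOn.mono hS'S).aestronglyMeasurable hS'm
  have hnormsq : ∀ u : L2Path T μ, MemLp (fun s => ‖u s‖) 2 (volume.restrict (Icc 0 T)) :=
    fun u => (Lp.memLp u).norm
  have hball : ∀ u ∈ controlBall T μ M, ∫ s in Icc 0 T, ‖u s‖ ^ 2 ≤ M := fun u hu => by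
    rw [integral_Icc_eq_integral_Ioc, ← intervalIntegral.integral_of_le hT.le]
    exact hu
  have hM : 0 ≤ M := (integral_nonneg fun s => sq_nonneg _).trans (hball h hh)
  have hcompL : ∀ u : L2Path T μ,
      MemLp (fun s => hΨ.compLp hΨ0 (u s)) 2 (volume.restrict (Icc 0 T)) := fun u =>
    (hΨ.lipschitzWith_compLp hΨ0).comp_memLp
      (LipschitzWith.compLp_zero hΨ hΨ0) (Lp.memLp u)
  have m0 : (0 : ℝ) ∈ Icc 0 T := ⟨le_rfl, hT.le⟩
  -- The bound `4 * M` comes from `‖hn - h‖² ≤ 2 ‖hn‖² + 2 ‖h‖²`, and also covers `η = ‖hn‖`.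
  have hfam : IsControlledFamily i T ((K : ℝ) + 1) (4 * M) C₁ b
      (fun n t => J (Yn n (pr t) - Y (pr t))) (fun n t => Zn n (pr t) - Z (pr t))
      (fun n s => hΨ.compLp hΨ0 (yn n s) - hΨ.compLp hΨ0 (y s)) (fun n s => yn n s - y s)
      (fun n s => J (B s (yn n s) (hn n s) - B s (y s) (h s))) β (fun n s => hn n s - h s)
      (fun n s => ‖hn n s‖) := by
    refine ⟨SubMarkovianSemigroup.F12.incl_injective P,
      SubMarkovianSemigroup.F12.denseRange_incl P, hT, by positivity, hC₁, hb0,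
      fun n => ⟨?_, (hcompL _).sub (hcompL _), (Lp.memLp _).sub (Lp.memLp _),
        J.toLinearIsometry.toContinuousLinearMap.integrable_comp ((hBIn n).sub hBI), fun t ht => ?_,
        fun t ht => ?_, ?_⟩,
      fun n => Eventually.of_forall fun s => norm_compLp_sub_sq_le hΨmono hΨ hΨ0 _ _,
      fun n => (Lp.memLp _).sub (Lp.memLp _), fun n => ?_, fun n => hnormsq _,
      fun n s => norm_nonneg _, fun n => (hball _ (hhn n)).trans (by linarith), hβm, ?_,
      fun n => ?_⟩
    · exact J.continuous.comp (((Yn n).continuous.comp hprc).sub hYc)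
    · have h1 := heqn n ⟨t, ht⟩
      have h2 := heq ⟨t, ht⟩
      have i1 : IntervalIntegrable (fun s => B s (yn n s) (hn n s)) volume 0 t :=
        Integrable.intervalIntegrable_of_mem (hBIn n) m0 ht
      have i2 : IntervalIntegrable (fun s => B s (y s) (h s)) volume 0 t :=
        Integrable.intervalIntegrable_of_mem hBI m0 ht
      have h3 : ∫ s in (0 : ℝ)..t, J (B s (yn n s) (hn n s) - B s (y s) (h s))
          = J (∫ s in (0 : ℝ)..t, (B s (yn n s) (hn n s) - B s (y s) (h s))) :=
        J.toLinearIsometry.toContinuousLinearMap.intervalIntegral_comp_comm (i1.sub i2)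
      rw [h3, hprm t ht, hi, ← SubMarkovianSemigroup.F12Dual.rieszSymm_extL, ← hJ, ← map_add,
        intervalIntegral.integral_sub i1 i2, map_sub P.extL]
      congr 1
      rw [sub_eq_iff_eq_add] at h1 h2
      rw [h1, h2]
      abel
    · rw [hprm t ht, map_sub, hZn n ⟨t, ht⟩, hZ ⟨t, ht⟩, intervalIntegral.integral_sub
        (((hcompL _).integrable one_le_two).intervalIntegrable_of_mem m0 ht)
        (((hcompL _).integrable one_le_two).intervalIntegrable_of_mem m0 ht)]
    · filter_upwards [hyE, hynE n] with s h1 h2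
      rw [h1, h2, ← map_sub P.embed, SubMarkovianSemigroup.F12Dual.rieszSymm_embed]
    · have i1 := (hnormsq (hn n)).integrable_sq.const_mul 2
      have i2 := (hnormsq h).integrable_sq.const_mul 2
      calc ∫ s in Icc 0 T, ‖hn n s - h s‖ ^ 2
          ≤ ∫ s in Icc 0 T, (2 * ‖hn n s‖ ^ 2 + 2 * ‖h s‖ ^ 2) := by
            refine integral_mono ((Lp.memLp (hn n)).sub (Lp.memLp h)).norm.integrable_sq
              (i1.add i2) fun s => ?_
            have h1 := norm_sub_le (hn n s) (h s)
            have h2 : ‖hn n s - h s‖ ^ 2 ≤ (‖hn n s‖ + ‖h s‖) ^ 2 := by gcongr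
            simp only
            nlinarith [sq_nonneg (‖hn n s‖ - ‖h s‖)]
        _ ≤ 4 * M := by
            rw [integral_add i1 i2, integral_const_mul, integral_const_mul]
            linarith [hball _ hh, hball _ (hhn n)]
    · filter_upwards [hSae] with s hs
      exact norm_le_of_hsNorm_le hb0 (hβhs s hs)
    · filter_upwards [hyE, hynE n, ae_restrict_mem measurableSet_Icc] with s h1 h2 hs
      -- Freezing the coefficient at the limit path leaves a term in which the Lipschitz bound for
      -- `B` meets the control `hn`.
      have h3 : J (B s (yn n s) (hn n s) - B s (y s) (h s)) - β s (hn n s - h s)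
          = J ((B s (yn n s) - B s (y s)) (hn n s)) := by
        have : β s (hn n s - h s) = J (B s (y s) (hn n s - h s)) := rfl
        rw [this, ← map_sub J]
        congr 1
        rw [map_sub, sub_apply]
        abel
      rw [h3, J.norm_map, J.norm_map, h1, h2]
      exact (ContinuousLinearMap.le_opNorm _ _).trans (by gcongr; exact hlip s hs _ _)
  rw [Metric.tendsto_nhds]
  intro ε hε
  filter_upwards [hfam.eventually_norm_le
    (fun f s hs t ht => tendsto_integral_inner_of_weak hweak f hs ht) hSae
    (fun s hs => mem_closure_regularRankOneSpan (SubMarkovianSemigroup.F12.incl_injective P) hb0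
      (hβhs s hs)) hβu
    (half_pos hε)] with n hn
  refine lt_of_le_of_lt ((ContinuousMap.dist_le (half_pos hε).le).2 fun t => ?_) (half_lt_self hε)
  have h1 := hn t t.2
  rwa [J.norm_map, hprm t t.2, ← dist_eq_norm] at h1
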